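/- A 3-restricted star colouring (3-rs colouring) of a graph $G$ is a map $f:V(G)\to\{0,1,2\}$ with $f(x)\ne f(y)$ for every edge $xy$ and with no path $x,y,z$ such that $f(y)>f(x)=f(z)$. A partially coloured rooted tree is a finite rooted tree some of whose vertices carry colours from $\{0,1,2\}$; its root is assumed to have degree at least $3$. It admits a 3-rs colouring extension if some 3-rs colouring of it agrees with the given colours. For a vertex $v$ of $T$ with $\deg_T(v)\neq 2$, the rooted subtree $T_v$ consists of $v$ and its descendants, with inherited colours; each child of $v$, together with its descendants and with $v$ as root, forms a branch of $T$ at $v$. Two branches (two rooted subtrees) are equivalent if replacing the first by the second in any partially coloured rooted tree yields a partially coloured rooted tree that admits a 3-rs colouring extension if and only if the original one does; the root of the inserted piece brings its own colour or lack of colour. Write $\circ$ for an uncoloured vertex and $0,1$ for vertices of that colour, and $r[s_1,\dots,s_m]$ for a root $r$ with subtrees $s_1,\dots,s_m$ below it. Classes A–F of branches are the equivalence classes of $$A:\ \circ[1[0]],\quad B:\ 0[\circ],\quad C:\ 1[0],\quad D:\ 1[\circ],\quad E:\ \circ[\circ[1]],\quad F:\ \circ[\circ].$$ Classes I–VII of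 rooted subtrees are the equivalence classes of $$\mathrm{I}:\ 1[0,0],\quad \mathrm{II}:\ 0,\quad \mathrm{III}:\ 1[0,\circ],\quad \mathrm{IV}:\ 1,\quad \mathrm{V}:\ \circ[\circ[1],\circ],\quad \mathrm{VI}:\ \circ[\circ,\circ],\quad \mathrm{VII}:\ \circ.$$ **Theorem.** 1. Both relations are equivalence relations, the six classes A–F are distinct, and the seven classes I–VII are distinct. Every uncoloured branch lies in exactly one of the classes A–F, and every uncoloured rooted subtree lies in exactly one of the classes I–VII. 2. (Table 1.) Let $B$ be a branch composed of a rooted subtree $T_u$ and an otherwise uncoloured path of length $d\ge 1$ from $u$ to the root of $B$. If $T_u$ is in class I, then $B$ is in class A. If $T_u$ is in another class, the class of $B$ for $d=1,2,3,\dots$ is given by - $T_u\in$ II: C, D, B, E, D, F, E, and F for $d\ge 8$; - $T_u\in$ III: A, B, C, D, B, E, D, F, E, and F for $d\ge 10$; - $T_u\in$ IV: B, E, D, F, E, and F for $d\ge 6$; - $T_u\in$ V: C, F, E, and F for $d\ge 4$; - $T_u\in$ VI: E, and F for $d\ge 2$; - $T_u\in$ VII: F for all $d\geq 1$. 3. (Table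 2.) Let $T_v$ be a rooted subtree such that $v$ is uncoloured or there is at least one branch at $v$, and suppose that every branch at $v$ is in one of the classes A–F. If some branch at $v$ is in class A, then $T_v$ is in class I. Otherwise let $b,c,d,e,f$ be the numbers of branches at $v$ in classes B, C, D, E, F. - If $b>0$: $T_v$ is in class II if $c+d=0$, and in class I if $c+d>0$. - If $b=0$ and $c+d>0$: $T_v$ is in class IV, III or I according as $c+e=0$, $c+e=1$ or $c+e\ge 2$. - If $b=c=d=0$: $T_v$ is in class VII if $e=f=0$, in class VI if $e=0<f$, in class V if $e=1$, and in class II if $e\geq 2$. 4. Consequently, applying the two tables from the leaves upwards computes the class of every uncoloured rooted subtree, and an uncoloured tree $T$ rooted at a vertex of degree at least $3$ is 3-rs colourable if and only if the class computed for $T$ is not I. Moreover, 3-rs colourability of trees can be tested in linear time: there are a program for a unit-cost random access machine whose only arithmetic operations are adding and subtracting $1$, and a constant $K$, such that for every tree with $n$ vertices, given by adjacency lists, the program halts after at most $Kn$ steps and decides correctly whether the tree is 3-rs colourable. -/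

import Mathlib

namespace RS

/-! ### Restricted star colourings -/

/-- `f` is a `k`-restricted star colouring of `G`: a proper `k`-colouring without a path
`x, y, z` such that `f y > f x = f z`. -/
def IsRSColouring {V : Type} (G : SimpleGraph V) (k : ℕ) (f : V → Fin k) : Prop :=
  (∀ x y, G.Adj x y → f x ≠ f y) ∧
    ∀ x y z, G.Adj x y → G.Adj y z → x ≠ z → f x = f z → ¬ f x < f y

/-- `G` is `k`-rs colourable. -/
def RSColourable {V : Type} (G : SimpleGraph V) (k : ℕ) : Prop :=
  ∃ f : V → Fin k, IsRSColouring G k f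

/-! ### Partially coloured rooted trees -/

/-- Finite rooted trees in which every vertex carries a colour from `{0, 1, 2}` or no colour. -/
inductive RTree : Type
  | node (colour : Option (Fin 3)) (children : List RTree) : RTree

namespace RTree

/-- The colour, if any, of the root. -/
def colour : RTree → Option (Fin 3)
  | node c _ => c

/-- The subtrees hanging below the root, one for each child of the root. -/
def children : RTree → List RTree
  | node _ ts => ts

/-- The tree formed by the vertex with address `p` and all its descendants. The root has address
`[]`; the `i`-th child (counted from `0`) of the vertex with address `p` has address `p ++ [i]`.
The value is `none` if no vertex has address `p`. -/
def sub? : List ℕ → RTree → Option RTree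
  | [], t => some t
  | i :: p, t => (t.children[i]?).bind (sub? p)

/-- The vertices of a tree, represented by their addresses. -/
def Vertex (t : RTree) : Type := {p : List ℕ // (t.sub? p).isSome}

/-- The tree as a simple graph: the edges join the vertices to their children. -/
def graph (t : RTree) : SimpleGraph t.Vertex where
  Adj x y := ∃ i : ℕ, y.1 = x.1 ++ [i] ∨ x.1 = y.1 ++ [i]
  symm := ⟨fun _ _ ⟨i, h⟩ => ⟨i, h.symm⟩⟩
  loopless := ⟨fun x ⟨i, h⟩ => by simp at h⟩

/-- The colour, if any, of the vertex with address `p`. -/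
def colourAt (t : RTree) (p : List ℕ) : Option (Fin 3) := (t.sub? p).bind colour

/-- No vertex is coloured. -/
def Uncoloured (t : RTree) : Prop := ∀ p, t.colourAt p = none

/-- The degree of the vertex with address `p`: the number of its children, plus one for its parent
unless it is the root. -/
def degAt (t : RTree) (p : List ℕ) : ℕ :=
  match t.sub? p with
  | none => 0
  | some s => s.children.length + if p = [] then 0 else 1

/-- The root is a vertex of degree three or more. -/
def ThreePlusRoot (t : RTree) : Prop := 3 ≤ t.degAt []

/-- The tree admits a 3-rs colouring extension: some 3-rs colouring of it agrees with all the
colours that are already present. -/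
def Extendable (t : RTree) : Prop :=
  ∃ f : t.Vertex → Fin 3, IsRSColouring t.graph 3 f ∧
    ∀ (x : t.Vertex) (c : Fin 3), t.colourAt x.1 = some c → f x = c

/-- Apply `g` to the subtree formed by the vertex with address `p` and its descendants. -/
def modifyAt (g : RTree → RTree) : List ℕ → RTree → RTree
  | [], t => g t
  | i :: p, t => node t.colour (t.children.modify i (modifyAt g p))

end RTree

open RTree

/-! ### Rooted subtrees and their equivalence -/

/-- `R` is the rooted subtree `T_v` of `T`, where `v` is the vertex with address `p`, the degree of
`v` in `T` is not two, and the root of `T` is a 3-plus vertex. -/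
def RootedSubtreeAt (T : RTree) (p : List ℕ) (R : RTree) : Prop :=
  T.ThreePlusRoot ∧ T.degAt p ≠ 2 ∧ T.sub? p = some R

/-- `R` is a rooted subtree of some partially coloured rooted tree. -/
def IsRootedSubtree (R : RTree) : Prop := ∃ T p, RootedSubtreeAt T p R

/-- The tree obtained from `T` by replacing the rooted subtree at the vertex with address `p`
by `R`. -/
def replaceSubtree (T : RTree) (p : List ℕ) (R : RTree) : RTree := T.modifyAt (fun _ => R) p

/-- Replacing the rooted subtree `R₁` by `R₂` preserves 3-rs colouring extension status in every
partially coloured rooted tree. Rooted trees have a 3-plus vertex as root, before and after the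
replacement; this is a restriction only if the whole tree is replaced. -/
def SubtreeEquiv (R₁ R₂ : RTree) : Prop :=
  ∀ T p, RootedSubtreeAt T p R₁ → (replaceSubtree T p R₂).ThreePlusRoot →
    (T.Extendable ↔ (replaceSubtree T p R₂).Extendable)

/-! ### Branches and their equivalence -/

/-- A branch: one of the pieces into which a rooted subtree `T_v` splits at `v`. It consists of the
root `v`, with its colour, and of one child of `v` with all the descendants of that child. -/
structure Branch where
  /-- the colour, if any, of the root of the branch -/
  rootColour : Option (Fin 3)
  /-- the child of the root, with its descendants -/
  top : RTree

/-- A branch as a rooted tree. -/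
def Branch.toTree (B : Branch) : RTree := node B.rootColour [B.top]

/-- `B` is the branch of `T` at the vertex `v` with address `p` that contains the `i`-th child
of `v`, where the degree of `v` in `T` is not two (hence at least three) and the root of `T` is a
3-plus vertex. The colours are inherited from `T`. -/
def BranchAt (T : RTree) (p : List ℕ) (i : ℕ) (B : Branch) : Prop :=
  ∃ R, RootedSubtreeAt T p R ∧ R.colour = B.rootColour ∧ R.children[i]? = some B.top

/-- The tree obtained from `T` by replacing the branch with the `i`-th child at the vertex with
address `p` by the branch `B`. That vertex, being the root of the branch that is replaced, takes the
colour (or the lack of a colour) of the root of `B`. -/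
def replaceBranch (T : RTree) (p : List ℕ) (i : ℕ) (B : Branch) : RTree :=
  T.modifyAt (fun R => node B.rootColour (R.children.set i B.top)) p

/-- Replacing the branch `B₁` by `B₂` preserves 3-rs colouring extension status in every partially
coloured rooted tree. -/
def BranchEquiv (B₁ B₂ : Branch) : Prop :=
  ∀ T p i, BranchAt T p i B₁ → (T.Extendable ↔ (replaceBranch T p i B₂).Extendable)

/-! ### The classes and their representatives -/

/-- The names of the six classes of branches. -/
inductive BranchClass : Type
  | A | B | C | D | E | F
  deriving DecidableEq

/-- The names of the seven classes of rooted subtrees. -/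
inductive SubtreeClass : Type
  | I | II | III | IV | V | VI | VII
  deriving DecidableEq

/-- The representatives of the six classes of branches. -/
def BranchClass.rep : BranchClass → Branch
  | A => ⟨none, node (some 1) [node (some 0) []]⟩
  | B => ⟨some 0, node none []⟩
  | C => ⟨some 1, node (some 0) []⟩
  | D => ⟨some 1, node none []⟩
  | E => ⟨none, node none [node (some 1) []]⟩
  | F => ⟨none, node none []⟩

/-- The representatives of the seven classes of rooted subtrees. -/
def SubtreeClass.rep : SubtreeClass → RTree
  | I => node (some 1) [node (some 0) [], node (some 0) []]
  | II => node (some 0) []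
  | III => node (some 1) [node (some 0) [], node none []]
  | IV => node (some 1) []
  | V => node none [node none [node (some 1) []], node none []]
  | VI => node none [node none [], node none []]
  | VII => node none []

/-- The branch `B` is in class `X`. -/
def InBranchClass (B : Branch) (X : BranchClass) : Prop := BranchEquiv B X.rep

/-- The rooted subtree `R` is in class `X`. -/
def InSubtreeClass (R : RTree) (X : SubtreeClass) : Prop := SubtreeEquiv R X.rep

/-! ### The two look-up tables -/

/-- The tree whose root is joined to the root of `R` by an uncoloured path of length `k`. -/
def chain : ℕ → RTree → RTree
  | 0, R => R
  | k + 1, R => node none [chain k R]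

/-- The branch composed of the rooted subtree `R = T_u` and an otherwise uncoloured `u,v`-path of
length `d ≥ 1` (the up-distance of the branch), where `v` is the root of the branch. -/
def branchOver (R : RTree) (d : ℕ) : Branch := ⟨none, chain (d - 1) R⟩

/-- The class of a branch with up-distance `d ≥ 1` composed of a rooted subtree of the given class
and a path. The rows `d = 1, …, 9` and `d ≥ 10` are listed down each column. -/
def branchTable (d : ℕ) : SubtreeClass → BranchClass
  | .I => .A
  | .II =>
    match d with
    | 1 => .C | 2 => .D | 3 => .B | 4 => .E | 5 => .D | 6 => .F | 7 => .E | _ => .F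
  | .III =>
    match d with
    | 1 => .A | 2 => .B | 3 => .C | 4 => .D | 5 => .B | 6 => .E | 7 => .D | 8 => .F | 9 => .E
    | _ => .F
  | .IV =>
    match d with
    | 1 => .B | 2 => .E | 3 => .D | 4 => .F | 5 => .E | _ => .F
  | .V =>
    match d with
    | 1 => .C | 2 => .F | 3 => .E | _ => .F
  | .VI =>
    match d with
    | 1 => .E | _ => .F
  | .VII => .F

/-- The class of a rooted subtree whose branches at the root have the listed classes. -/
def subtreeTable (L : List BranchClass) : SubtreeClass :=
  let b := L.count .B
  let c := L.count .C
  let d := L.count .D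
  let e := L.count .E
  let f := L.count .F
  if 0 < L.count .A then .I
  else if 0 < b then
    if c + d = 0 then .II else .I
  else if 0 < c + d then
    if c + e = 0 then .IV else if c + e = 1 then .III else .I
  else
    if e = 0 then
      if f = 0 then .VII else .VI
    else if e = 1 then .V else .II

mutual
/-- The class that the two tables assign to a branch, computed from the bottom up. The branch
consists of the tree in the first argument and a path of length `d` from its root to the root of
the branch. -/
def tableBranchClass : RTree → ℕ → BranchClass
  | node _ [], d => branchTable d (subtreeTable [])
  | node _ [t], d => tableBranchClass t (d + 1)
  | node _ (t₁ :: t₂ :: ts), d =>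
    branchTable d
      (subtreeTable (tableBranchClass t₁ 1 :: tableBranchClass t₂ 1 :: tableBranchClasses ts))
/-- The classes that the tables assign to the branches with the listed children of the root. -/
def tableBranchClasses : List RTree → List BranchClass
  | [] => []
  | t :: ts => tableBranchClass t 1 :: tableBranchClasses ts
end

/-- The class that the two tables assign to a rooted subtree, computed from the bottom up. -/
def tableClass (R : RTree) : SubtreeClass := subtreeTable (tableBranchClasses R.children)

/-! ### A random access machine with unit-cost steps

The machine has registers and arrays that hold natural numbers; its only arithmetic operations are
adding and subtracting one. -/

/-- The memory: registers, and arrays with natural number indices. -/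
structure Mem where
  /-- the contents of the registers -/
  reg : ℕ → ℕ
  /-- `arr a j` is the entry with index `j` of array `a` -/
  arr : ℕ → ℕ → ℕ

/-- Comparisons of two registers. -/
inductive Test : Type
  | eq (x y : ℕ) : Test
  | lt (x y : ℕ) : Test

/-- The outcome of a comparison. -/
def Test.Holds (m : Mem) : Test → Prop
  | eq x y => m.reg x = m.reg y
  | lt x y => m.reg x < m.reg y

/-- Programs. In the instructions `x`, `y` are names of registers and `a` is the name of an array;
`load x a y` reads into `x` the entry of `a` whose index is the content of `y`, and `store a y x`
writes the content of `x` to that entry. -/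
inductive Prog : Type
  | const (x k : ℕ) : Prog
  | copy (x y : ℕ) : Prog
  | inc (x : ℕ) : Prog
  | dec (x : ℕ) : Prog
  | load (x a y : ℕ) : Prog
  | store (a y x : ℕ) : Prog
  | seq (p q : Prog) : Prog
  | cond (b : Test) (p q : Prog) : Prog
  | loop (b : Test) (p : Prog) : Prog

/-- The memory after writing `k` to register `x`. -/
def Mem.setReg (m : Mem) (x k : ℕ) : Mem := { m with reg := Function.update m.reg x k }

/-- The memory after writing `k` to the entry with index `j` of array `a`. -/
def Mem.setArr (m : Mem) (a j k : ℕ) : Mem :=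
  { m with arr := Function.update m.arr a (Function.update (m.arr a) j k) }

/-- `Exec p m t m'`: started with memory `m`, the program `p` halts after exactly `t` steps with
memory `m'`. Every instruction and every evaluation of a comparison is one step. -/
inductive Exec : Prog → Mem → ℕ → Mem → Prop
  | const (m : Mem) (x k : ℕ) : Exec (.const x k) m 1 (m.setReg x k)
  | copy (m : Mem) (x y : ℕ) : Exec (.copy x y) m 1 (m.setReg x (m.reg y))
  | inc (m : Mem) (x : ℕ) : Exec (.inc x) m 1 (m.setReg x (m.reg x + 1))
  | dec (m : Mem) (x : ℕ) : Exec (.dec x) m 1 (m.setReg x (m.reg x - 1))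
  | load (m : Mem) (x a y : ℕ) : Exec (.load x a y) m 1 (m.setReg x (m.arr a (m.reg y)))
  | store (m : Mem) (a y x : ℕ) : Exec (.store a y x) m 1 (m.setArr a (m.reg y) (m.reg x))
  | seq {p q : Prog} {m m₁ m₂ : Mem} {t₁ t₂ : ℕ} :
      Exec p m t₁ m₁ → Exec q m₁ t₂ m₂ → Exec (.seq p q) m (t₁ + t₂) m₂
  | condTrue {b : Test} {p q : Prog} {m m' : Mem} {t : ℕ} :
      b.Holds m → Exec p m t m' → Exec (.cond b p q) m (t + 1) m'
  | condFalse {b : Test} {p q : Prog} {m m' : Mem} {t : ℕ} :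
      ¬ b.Holds m → Exec q m t m' → Exec (.cond b p q) m (t + 1) m'
  | loopTrue {b : Test} {p : Prog} {m m₁ m₂ : Mem} {t₁ t₂ : ℕ} :
      b.Holds m → Exec p m t₁ m₁ → Exec (.loop b p) m₁ t₂ m₂ →
        Exec (.loop b p) m (t₁ + t₂ + 1) m₂
  | loopFalse {b : Test} {p : Prog} {m : Mem} :
      ¬ b.Holds m → Exec (.loop b p) m 1 m

/-- `adj` is an adjacency list representation of `G`: the neighbours of every vertex are listed
without repetition, in an arbitrary order. -/
def IsAdjList {n : ℕ} (G : SimpleGraph (Fin n)) (adj : Fin n → List (Fin n)) : Prop :=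
  ∀ v, (adj v).Nodup ∧ ∀ w, w ∈ adj v ↔ G.Adj v w

/-- The initial memory. Register `0` holds the number `n` of vertices. Array `1` holds the
neighbour lists of the vertices `0, 1, …, n - 1`, one after the other; the list of the vertex `v`
occupies the entries whose index `j` satisfies `s v ≤ j < s (v + 1)`, where array `0` holds
`s 0, …, s n`. Everything else is `0`. -/
def inputMem {n : ℕ} (adj : Fin n → List (Fin n)) : Mem where
  reg x := if x = 0 then n else 0
  arr a j :=
    if a = 0 then
      if j ≤ n then (((List.finRange n).take j).flatMap adj).length else 0
    else if a = 1 then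
      ((((List.finRange n).flatMap adj)[j]?).map Fin.val).getD 0
    else 0

/-- The program `p` tests 3-rs colourability of trees in linear time: there is a constant `K` such
that, for every tree with `n` vertices given by adjacency lists, `p` halts after at most `K * n`
steps, with `1` in register `0` if the tree is 3-rs colourable, and with `0` otherwise. -/
def TestsTreesInLinearTime (p : Prog) : Prop :=
  ∃ K : ℕ, ∀ (n : ℕ) (G : SimpleGraph (Fin n)) (adj : Fin n → List (Fin n)),
    G.IsTree → IsAdjList G adj →
      ∃ (t : ℕ) (m : Mem), Exec p (inputMem adj) t m ∧ t ≤ K * n ∧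
        (RSColourable G 3 → m.reg 0 = 1) ∧ (¬ RSColourable G 3 → m.reg 0 = 0)

end RS

namespace RS

open RTree

/-! ### Feasibility of colours at the root -/

-- The condition on a 3-rs colouring is local: at a vertex of colour `c` no neighbour has colour
-- `c`, and each colour below `c` occurs at most once among the neighbours (`NbOk`). Hence a subtree
-- influences the rest of a tree only through the feasible pairs (colour of its root, colour of the
-- parent), which `feas` computes recursively.
--
-- A vertex of colour 2 has at most two neighbours, so a vertex of degree at least three has colour
-- 0 or 1. With colour 0 its branches are independent of each other; with colour 1 at most one
-- neighbour has colour 0. A branch therefore matters only through three Booleans (`branchSig`):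
-- root 0 is possible, root 1 is possible, root 1 is possible without a neighbour of colour 0. The
-- third implies the second, so six triples remain: A–F. A rooted subtree matters only through four
-- feasible pairs (`subtreeSig`). Conversely, small test trees detect each signature, so equivalence
-- is equality of signatures (`branchEquiv_iff`, `subtreeEquiv_iff`).
--
-- The first table follows by iterating the effect of one uncoloured vertex on the feasible pairs,
-- which stabilises (`sigOfPairs_iterate`). The second expresses `subtreeSig` through the numbers of
-- branches of each class (`subtreeSig_eq`, `subtreeTable_sig`). That uncoloured rooted subtrees
-- fall into only seven classes comes from these tables, by structural induction.
--
-- The linear-time program does not evaluate the tables. It finds a search order and deletes leaves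
-- in reverse order, keeping at each vertex one of finitely many states that summarises the deleted
-- part (`peelSolvable_insert`). The update of a state is a look-up of constant cost.

/-- The colour `c` is admitted by the given colour, if any. -/
def fits : Option (Fin 3) → Fin 3 → Bool
  | none, _ => true
  | some d, c => d == c

/-- A vertex of colour `c` may have neighbours with the listed colours. -/
def NbOk (c : Fin 3) (l : List (Fin 3)) : Prop := c ∉ l ∧ ∀ j < c, l.count j ≤ 1

instance (c : Fin 3) (l : List (Fin 3)) : Decidable (NbOk c l) :=
  inferInstanceAs (Decidable (_ ∧ _))

mutual
/-- The tree has a 3-rs colouring extension with root colour `c` that is compatible with a parent of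
colour `P` above the root. -/
def feas : RTree → Fin 3 → Option (Fin 3) → Bool
  | node col ts, c, P => fits col c && feasList ts c P.toList
/-- The listed trees can be coloured and hung below a vertex of colour `c` that already has
neighbours with the colours `l`. -/
def feasList : List RTree → Fin 3 → List (Fin 3) → Bool
  | [], c, l => decide (NbOk c l)
  | t :: ts, c, l =>
    (feas t 0 (some c) && feasList ts c (0 :: l)) ||
    ((feas t 1 (some c) && feasList ts c (1 :: l)) ||
    (feas t 2 (some c) && feasList ts c (2 :: l)))
end

theorem feasList_cons_iff {t : RTree} {ts : List RTree} {c : Fin 3} {l : List (Fin 3)} :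
    feasList (t :: ts) c l = true ↔
      ∃ g, feas t g (some c) = true ∧ feasList ts c (g :: l) = true := by
  rw [feasList]
  constructor
  · intro h
    simp only [Bool.or_eq_true, Bool.and_eq_true] at h
    rcases h with h | h | h
    exacts [⟨_, h⟩, ⟨_, h⟩, ⟨_, h⟩]
  · rintro ⟨g, h⟩
    simp only [Bool.or_eq_true, Bool.and_eq_true]
    fin_cases g
    exacts [Or.inl h, Or.inr (Or.inl h), Or.inr (Or.inr h)]

theorem feas_iff {t : RTree} {c : Fin 3} {P : Option (Fin 3)} :
    feas t c P = true ↔ fits t.colour c = true ∧ feasList t.children c P.toList = true := by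
  cases t with
  | node col ts => simp [feas, colour, children]

theorem NbOk.perm {c : Fin 3} {l l' : List (Fin 3)} (h : l.Perm l') (hl : NbOk c l) :
    NbOk c l' :=
  ⟨fun hc => hl.1 (h.mem_iff.2 hc), fun j hj => (h.count_eq j) ▸ hl.2 j hj⟩

/-! ### Colourings as functions of addresses -/

/-- The colours of the neighbours of the vertex with address `x`, which has `k` children; `P` is the
colour of a parent of the root. -/
def nbColours (f : List ℕ → Fin 3) (P : Option (Fin 3)) (x : List ℕ) (k : ℕ) : List (Fin 3) :=
  (if x = [] then P.toList else [f x.dropLast]) ++ (List.range k).map fun i => f (x ++ [i])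

/-- The function `f` of addresses is a 3-rs colouring extension of `t`, which is compatible with a
parent of colour `P` above the root. -/
def GoodCol (t : RTree) (f : List ℕ → Fin 3) (P : Option (Fin 3)) : Prop :=
  ∀ x s, t.sub? x = some s →
    fits s.colour (f x) = true ∧ NbOk (f x) (nbColours f P x s.children.length)

theorem goodCol_iff {t : RTree} {f : List ℕ → Fin 3} {P : Option (Fin 3)} :
    GoodCol t f P ↔ (fits t.colour (f []) = true ∧
      NbOk (f []) (P.toList ++ (List.range t.children.length).map fun i => f [i])) ∧
      ∀ i s, t.children[i]? = some s → GoodCol s (fun x => f (i :: x)) (some (f [])) := by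
  have key : ∀ i x k, nbColours f P (i :: x) k
      = nbColours (fun y => f (i :: y)) (some (f [])) x k := by
    intro i x k
    cases x <;> simp [nbColours]
  constructor
  · intro h
    refine ⟨by simpa [nbColours] using h [] t rfl, fun i s hs x r hr => ?_⟩
    have := h (i :: x) r (by simp [sub?, hs, hr])
    rwa [key] at this
  · rintro ⟨h1, h2⟩ x s hs
    cases x with
    | nil =>
      obtain rfl : t = s := by simpa [sub?] using hs
      simpa [nbColours] using h1
    | cons i x =>
      rw [sub?] at hs
      obtain ⟨r, hr, hs⟩ := Option.bind_eq_some_iff.1 hs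
      rw [key]
      exact h2 i r hr x s hs

theorem nbOk_snoc {c : Fin 3} {l : List (Fin 3)} {k : ℕ} {h : ℕ → Fin 3} :
    NbOk c ((h 0 :: l) ++ (List.range k).map fun i => h (i + 1)) ↔
      NbOk c (l ++ (List.range (k + 1)).map h) := by
  have : ((h 0 :: l) ++ (List.range k).map fun i => h (i + 1)).Perm
      (l ++ (List.range (k + 1)).map h) := by
    rw [List.range_succ_eq_map, List.map_cons, List.map_map]
    exact (List.perm_middle (a := h 0)).symm
  exact ⟨NbOk.perm this, NbOk.perm this.symm⟩

-- The subtrees at the children interact only through the colours of their roots, so their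
-- colourings glue. Functions on all lists, rather than on vertices, make the gluing a case
-- distinction on the first entry of the address.
mutual
theorem feas_iff_exists_goodCol : ∀ (t : RTree) (c : Fin 3) (P : Option (Fin 3)),
    feas t c P = true ↔ ∃ f : List ℕ → Fin 3, f [] = c ∧ GoodCol t f P
  | node col ts, c, P => by
    rw [feas, Bool.and_eq_true, feasList_iff_exists_goodCol ts c P.toList]
    constructor
    · rintro ⟨h1, h, h2, h3⟩
      refine ⟨fun x => match x with
        | [] => c
        | i :: x => h i x, rfl, goodCol_iff.2 ⟨⟨h1, h3⟩, h2⟩⟩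
    · rintro ⟨f, rfl, h⟩
      obtain ⟨⟨h1, h2⟩, h3⟩ := goodCol_iff.1 h
      exact ⟨h1, fun i x => f (i :: x), h3, h2⟩
theorem feasList_iff_exists_goodCol : ∀ (ts : List RTree) (c : Fin 3) (l : List (Fin 3)),
    feasList ts c l = true ↔ ∃ h : ℕ → List ℕ → Fin 3,
      (∀ i s, ts[i]? = some s → GoodCol s (h i) (some c)) ∧
        NbOk c (l ++ (List.range ts.length).map fun i => h i [])
  | [], c, l => by simp [feasList]
  | t :: ts, c, l => by
    rw [feasList_cons_iff]
    constructor
    · rintro ⟨g, h1, h2⟩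
      obtain ⟨f, rfl, hf⟩ := (feas_iff_exists_goodCol t g (some c)).1 h1
      obtain ⟨h, hh, hn⟩ := (feasList_iff_exists_goodCol ts c (f [] :: l)).1 h2
      refine ⟨fun i => match i with
        | 0 => f
        | i + 1 => h i, ?_, ?_⟩
      · rintro (_ | i) s hs
        · simp only [List.getElem?_cons_zero, Option.some.injEq] at hs
          exact hs ▸ hf
        · exact hh i s (by simpa using hs)
      · exact nbOk_snoc.1 hn
    · rintro ⟨h, hh, hn⟩
      refine ⟨h 0 [], (feas_iff_exists_goodCol t _ (some c)).2 ⟨h 0, rfl, hh 0 t rfl⟩,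
        (feasList_iff_exists_goodCol ts c _).2 ⟨fun i => h (i + 1), fun i s hs => ?_, ?_⟩⟩
      · exact hh (i + 1) s (by simpa using hs)
      · exact (nbOk_snoc (h := fun i => h i [])).2 hn
end

/-! ### Colouring extensions -/

theorem sub?_append (t : RTree) (x y : List ℕ) :
    t.sub? (x ++ y) = (t.sub? x).bind (sub? y) := by
  induction x generalizing t with
  | nil => simp [sub?]
  | cons i x ih =>
    simp only [List.cons_append, sub?, Option.bind_assoc]
    congr 1
    funext s
    exact ih s

theorem sub?_singleton (t : RTree) (i : ℕ) : t.sub? [i] = t.children[i]? := by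
  rw [sub?]
  cases t.children[i]? <;> rfl

/-- The addresses of the neighbours of the vertex with address `x`, which has `k` children. -/
def nbAddresses (x : List ℕ) (k : ℕ) : List (List ℕ) :=
  (if x = [] then [] else [x.dropLast]) ++ (List.range k).map fun i => x ++ [i]

theorem nodup_nbAddresses (x : List ℕ) (k : ℕ) : (nbAddresses x k).Nodup := by
  have h1 : ((List.range k).map fun i => x ++ [i]).Nodup :=
    List.nodup_range.map fun i j h => by simpa using h
  unfold nbAddresses
  split_ifs with hx
  · simpa using h1
  · rw [List.singleton_append, List.nodup_cons]
    refine ⟨fun h => ?_, h1⟩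
    obtain ⟨i, -, hi⟩ := List.mem_map.1 h
    have := congrArg List.length hi
    simp at this
    omega

theorem mem_nbAddresses {t s : RTree} {x : List ℕ} (hx : t.sub? x = some s) {y : List ℕ} :
    y ∈ nbAddresses x s.children.length ↔
      (t.sub? y).isSome = true ∧ ∃ i : ℕ, x = y ++ [i] ∨ y = x ++ [i] := by
  have h1 : y ∈ nbAddresses x s.children.length ↔
      (x ≠ [] ∧ y = x.dropLast) ∨ ∃ i < s.children.length, x ++ [i] = y := by
    unfold nbAddresses
    split_ifs with h <;> simp [h]
  rw [h1]
  constructor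
  · rintro (⟨h, rfl⟩ | ⟨i, hi, rfl⟩)
    · refine ⟨?_, x.getLast h, Or.inl (List.dropLast_append_getLast h).symm⟩
      rw [← List.dropLast_append_getLast h, sub?_append] at hx
      obtain ⟨r, hr, -⟩ := Option.bind_eq_some_iff.1 hx
      simp [hr]
    · refine ⟨?_, i, Or.inr rfl⟩
      simp [sub?_append, hx, sub?_singleton, hi]
  · rintro ⟨h, i, rfl | rfl⟩
    · left; simp
    · right
      refine ⟨i, ?_, rfl⟩
      simpa [sub?_append, hx, sub?_singleton] using h

theorem nbColours_none (f : List ℕ → Fin 3) (x : List ℕ) (k : ℕ) :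
    nbColours f none x k = (nbAddresses x k).map f := by
  unfold nbColours nbAddresses
  split_ifs <;> simp [Function.comp_def]

/-- Translates between the multiplicities in `NbOk` and the paths in `IsRSColouring`; distinctness
of the listed neighbours is what makes equal colours a repeated colour. -/
theorem count_map_le_one_iff {α : Type*} {l : List α} (hl : l.Nodup) (F : α → Fin 3) (j : Fin 3) :
    (l.map F).count j ≤ 1 ↔ ∀ a ∈ l, ∀ b ∈ l, F a = j → F b = j → a = b := by
  induction l with
  | nil => simp
  | cons a l ih =>
    rw [List.nodup_cons] at hl
    have ih := ih hl.2
    by_cases ha : F a = j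
    · have h0 : ((a :: l).map F).count j ≤ 1 ↔ (l.map F).count j = 0 := by
        simp [ha]
      rw [h0, List.count_eq_zero]
      constructor
      · intro h b hb c hc h1 h2
        have key : ∀ b ∈ a :: l, F b = j → b = a := by
          intro b hb hj
          rcases List.mem_cons.1 hb with rfl | hb
          · rfl
          · exact (h (List.mem_map.2 ⟨b, hb, hj⟩)).elim
        rw [key b hb h1, key c hc h2]
      · intro h hj
        obtain ⟨b, hb, hbj⟩ := List.mem_map.1 hj
        have := h a (by simp) b (by simp [hb]) ha hbj
        exact hl.1 (this ▸ hb)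
    · rw [List.map_cons, List.count_cons_of_ne ha, ih]
      constructor
      · intro h b hb c hc h1 h2
        rcases List.mem_cons.1 hb with rfl | hb
        · exact (ha h1).elim
        rcases List.mem_cons.1 hc with rfl | hc
        · exact (ha h2).elim
        exact h b hb c hc h1 h2
      · intro h b hb c hc
        exact h b (by simp [hb]) c (by simp [hc])

theorem fits_iff {o : Option (Fin 3)} {c : Fin 3} :
    fits o c = true ↔ ∀ d, o = some d → c = d := by
  cases o with
  | none => simp [fits]
  | some d => simp [fits, @eq_comm _ c]

theorem extendable_iff {t : RTree} : t.Extendable ↔ ∃ c, feas t c none = true := by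
  simp only [feas_iff_exists_goodCol]
  constructor
  · rintro ⟨f, ⟨hp, hq⟩, hc⟩
    classical
    -- The value 0 off the tree is immaterial: `GoodCol` evaluates the function only at addresses of
    -- vertices.
    set F : List ℕ → Fin 3 := fun x => if h : (t.sub? x).isSome then f ⟨x, h⟩ else 0 with hF
    have hFv : ∀ x (h : (t.sub? x).isSome), f ⟨x, h⟩ = F x := by
      intro x h
      simp [hF, h]
    refine ⟨_, F, rfl, fun x s hs => ?_⟩
    have hx : (t.sub? x).isSome := by simp [hs]
    refine ⟨fits_iff.2 fun d hd => ?_, ?_, fun j hj => ?_⟩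
    · exact (hFv x hx).symm.trans (hc ⟨x, hx⟩ d (by simp [colourAt, hs, hd]))
    · rw [nbColours_none, List.mem_map]
      rintro ⟨y, hy, hyx⟩
      obtain ⟨hy, i, hi⟩ := (mem_nbAddresses hs).1 hy
      exact hp ⟨y, hy⟩ ⟨x, hx⟩ ⟨i, hi⟩ ((hFv y hy).trans (hyx.trans (hFv x hx).symm))
    · rw [nbColours_none, count_map_le_one_iff (nodup_nbAddresses _ _)]
      intro a ha b hb haj hbj
      by_contra hab
      obtain ⟨ha, i, hi⟩ := (mem_nbAddresses hs).1 ha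
      obtain ⟨hb, k, hk⟩ := (mem_nbAddresses hs).1 hb
      refine hq ⟨a, ha⟩ ⟨x, hx⟩ ⟨b, hb⟩ ⟨i, hi⟩ ⟨k, hk.symm⟩ (fun h => hab (congrArg Subtype.val h))
        ((hFv a ha).trans ((haj.trans hbj.symm).trans (hFv b hb).symm)) ?_
      exact ((hFv a ha).trans haj).trans_lt (hj.trans_eq (hFv x hx).symm)
  · rintro ⟨c, f, -, h⟩
    refine ⟨fun x => f x.1, ⟨fun x y hxy => ?_, fun x y z hxy hyz hne hxz hlt => ?_⟩,
      fun x c hc => ?_⟩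
    · obtain ⟨s, hs⟩ := Option.isSome_iff_exists.1 y.2
      have := (h _ s hs).2.1
      rw [nbColours_none] at this
      exact fun he => this (List.mem_map.2 ⟨x.1, (mem_nbAddresses hs).2 ⟨x.2, hxy⟩, he⟩)
    · obtain ⟨s, hs⟩ := Option.isSome_iff_exists.1 y.2
      have := (h _ s hs).2.2 _ hlt
      rw [nbColours_none, count_map_le_one_iff (nodup_nbAddresses _ _)] at this
      exact hne (Subtype.ext (this _ ((mem_nbAddresses hs).2 ⟨x.2, hxy⟩) _
        ((mem_nbAddresses hs).2 ⟨z.2, hyz.imp fun _ => Or.symm⟩) rfl hxz.symm))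
    · obtain ⟨s, hs⟩ := Option.isSome_iff_exists.1 x.2
      exact fits_iff.1 (h _ s hs).1 c (by simpa [colourAt, hs] using hc)

/-! ### Feasibility by colour of the root -/

theorem nbOk_zero {l : List (Fin 3)} : NbOk 0 l ↔ 0 ∉ l := by
  simp [NbOk]

theorem nbOk_one {l : List (Fin 3)} : NbOk 1 l ↔ 1 ∉ l ∧ l.count 0 ≤ 1 := by
  refine and_congr_right fun _ => ⟨fun h => h 0 (by decide), fun h j hj => ?_⟩
  obtain rfl : j = 0 := by omega
  exact h

/-- The neighbours of a vertex of colour 2 have colours 0 and 1, each at most once. This is where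
degree three enters the whole argument. -/
theorem NbOk.length_le {l : List (Fin 3)} (h : NbOk 2 l) : l.length ≤ 2 := by
  have h0 := h.2 0 (by decide)
  have h1 := h.2 1 (by decide)
  have h2 := List.count_eq_zero.2 h.1
  have : l.length = l.count 0 + l.count 1 + l.count 2 := by
    clear h h0 h1 h2
    induction l with
    | nil => rfl
    | cons a l ih =>
      fin_cases a <;> simp [ih] <;> omega
  omega

theorem feasList_two_eq_false {ts : List RTree} {l : List (Fin 3)}
    (h : 3 ≤ ts.length + l.length) : feasList ts 2 l = false := by
  induction ts generalizing l with
  | nil =>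
    simp only [feasList, decide_eq_false_iff_not]
    intro hl
    have := hl.length_le
    simp at h
    omega
  | cons t ts ih =>
    have : ∀ g : Fin 3, feasList ts 2 (g :: l) = false := fun g =>
      ih (by simp only [List.length_cons] at h ⊢; omega)
    simp [feasList, this]

/-- The tree can be hung below a vertex of colour `0`. -/
def underZero (t : RTree) : Bool := feas t 1 (some 0) || feas t 2 (some 0)

/-- The tree can be hung below a vertex of colour `1`. -/
def underOne (t : RTree) : Bool := feas t 0 (some 1) || feas t 2 (some 1)

/-- The tree can be hung below a vertex of colour `1` without using a neighbour of colour `0`. -/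
def underOneFree (t : RTree) : Bool := feas t 2 (some 1)

theorem underOne_of_underOneFree {t : RTree} (h : underOneFree t = true) : underOne t = true := by
  simp only [underOne, underOneFree] at *
  simp [h]

theorem feas_self {t : RTree} {c : Fin 3} : feas t c (some c) = false := by
  suffices h : ∀ (ts : List RTree) (l : List (Fin 3)), c ∈ l → feasList ts c l = false by
    cases t with
    | node col ts => simp [feas, h]
  intro ts
  induction ts with
  | nil => intro l hl; simp [feasList, NbOk, hl]
  | cons t ts ih => intro l hl; simp [feasList, ih, hl]

/-- No colour lies below 0, so the children choose their colours independently. -/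
theorem feasList_zero {ts : List RTree} {l : List (Fin 3)} :
    feasList ts 0 l = true ↔ 0 ∉ l ∧ ∀ t ∈ ts, underZero t = true := by
  induction ts generalizing l with
  | nil => simp [feasList, nbOk_zero]
  | cons t ts ih =>
    simp only [feasList_cons_iff, ih, underZero, List.mem_cons, forall_eq_or_imp, Bool.or_eq_true]
    constructor
    · rintro ⟨g, h1, h2, h3⟩
      refine ⟨fun h => h2 (Or.inr h), ?_, h3⟩
      fin_cases g
      · simp at h2
      · exact Or.inl h1
      · exact Or.inr h1
    · rintro ⟨h1, h2 | h2, h3⟩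
      · exact ⟨1, h2, by simpa using h1, h3⟩
      · exact ⟨2, h2, by simpa using h1, h3⟩

/-- A child takes colour 2 whenever it can; the count is of those that are forced to take colour 0,
of which only one is allowed, including the neighbours in `l`. -/
theorem feasList_one {ts : List RTree} {l : List (Fin 3)} :
    feasList ts 1 l = true ↔ 1 ∉ l ∧ (∀ t ∈ ts, underOne t = true) ∧
      (ts.countP fun t => !underOneFree t) + l.count 0 ≤ 1 := by
  induction ts generalizing l with
  | nil => simp [feasList, nbOk_one]
  | cons t ts ih =>
    simp only [feasList_cons_iff, ih, List.mem_cons, forall_eq_or_imp, List.countP_cons]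
    constructor
    · rintro ⟨g, h1, h2, h3, h4⟩
      refine ⟨fun h => h2 (Or.inr h), ⟨?_, h3⟩, ?_⟩
      · fin_cases g
        · simp only [underOne, Bool.or_eq_true]; exact Or.inl h1
        · simp at h2
        · simp only [underOne, Bool.or_eq_true]; exact Or.inr h1
      · fin_cases g
        · simp only [Fin.zero_eta, List.count_cons_self] at h4
          split_ifs <;> omega
        · simp at h2
        · have h1 : underOneFree t = true := h1
          rw [List.count_cons_of_ne (by decide)] at h4
          simpa [h1] using h4
    · rintro ⟨h1, ⟨h2, h3⟩, h4⟩
      by_cases hf : underOneFree t = true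
      · refine ⟨2, hf, by simpa using h1, h3, ?_⟩
        rw [List.count_cons_of_ne (by decide)]
        simpa [hf] using h4
      · have h0 : feas t 0 (some 1) = true := by
          simp only [underOne, Bool.or_eq_true] at h2
          exact h2.resolve_right hf
        refine ⟨0, h0, by simpa using h1, h3, ?_⟩
        simp only [hf, List.count_cons_self] at h4 ⊢
        simp at h4
        omega

theorem feas_zero_iff {t : RTree} {P : Option (Fin 3)} :
    feas t 0 P = true ↔ P ≠ some 0 ∧ fits t.colour 0 = true ∧
      ∀ s ∈ t.children, underZero s = true := by
  rw [feas_iff, feasList_zero]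
  have : (0 : Fin 3) ∉ P.toList ↔ P ≠ some 0 := by simp
  rw [this]
  tauto

theorem feas_one_iff {t : RTree} {P : Option (Fin 3)} :
    feas t 1 P = true ↔ P ≠ some 1 ∧ fits t.colour 1 = true ∧
      (∀ s ∈ t.children, underOne s = true) ∧
      (t.children.countP fun s => !underOneFree s) + P.toList.count 0 ≤ 1 := by
  rw [feas_iff, feasList_one]
  have : (1 : Fin 3) ∉ P.toList ↔ P ≠ some 1 := by simp
  rw [this]
  tauto

theorem feas_two_eq_false {t : RTree} {P : Option (Fin 3)}
    (h : 3 ≤ t.children.length + P.toList.length) : feas t 2 P = false := by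
  cases t with
  | node col ts => simp [feas, feasList_two_eq_false (ts := ts) h]

/-! ### Replacement -/

theorem feasList_modify {ts : List RTree} {i : ℕ} {h : RTree → RTree}
    (hh : ∀ t, ts[i]? = some t → ∀ c q, feas (h t) c (some q) = feas t c (some q))
    (c : Fin 3) (l : List (Fin 3)) : feasList (ts.modify i h) c l = feasList ts c l := by
  induction ts generalizing i l with
  | nil => simp
  | cons t ts ih =>
    cases i with
    | zero =>
      have := hh t rfl
      simp [feasList, this]
    | succ i =>
      have := fun l => ih (i := i) (l := l) (fun s hs => hh s (by simpa using hs))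
      simp [feasList, this]

/-- A proper subtree is seen by the rest of the tree only through the colours of its root and of its
parent. At the address `[]` there is no parent, and that case is treated separately. -/
theorem feas_modifyAt {g : RTree → RTree} {p : List ℕ} {T R : RTree} (hT : T.sub? p = some R)
    (hp : p ≠ []) (hg : ∀ c q, feas (g R) c (some q) = feas R c (some q)) (c : Fin 3)
    (P : Option (Fin 3)) : feas (T.modifyAt g p) c P = feas T c P := by
  induction p generalizing T c P with
  | nil => exact (hp rfl).elim
  | cons i p ih =>
    obtain ⟨s, hs, hR⟩ := Option.bind_eq_some_iff.1 hT
    cases T with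
    | node col ts =>
      rw [modifyAt, feas, feas]
      congr 1
      refine feasList_modify (fun t ht d q => ?_) c P.toList
      obtain rfl : t = s := Option.some.inj (ht.symm.trans hs)
      cases p with
      | nil =>
        obtain rfl : t = R := by simpa [sub?] using hR
        exact hg d q
      | cons j p => exact ih hR (by simp) d (some q)

theorem threePlusRoot_iff {T : RTree} : T.ThreePlusRoot ↔ 3 ≤ T.children.length := by
  simp [ThreePlusRoot, degAt, sub?]

theorem degAt_eq {T R : RTree} {p : List ℕ} (h : T.sub? p = some R) :
    T.degAt p = R.children.length + if p = [] then 0 else 1 := by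
  simp [degAt, h]

/-! ### Rooted subtrees -/

/-- A vertex other than the root has degree two exactly if it has one child, and the root of the
ambient tree has at least three. Three copies of `R` below a new root realise every other `R`. -/
theorem isRootedSubtree_iff {R : RTree} : IsRootedSubtree R ↔ R.children.length ≠ 1 := by
  constructor
  · rintro ⟨T, p, hT, hd, hR⟩ h
    rw [degAt_eq hR, h] at hd
    by_cases hp : p = []
    · subst hp
      obtain rfl : T = R := by simpa [sub?] using hR
      rw [threePlusRoot_iff] at hT
      omega
    · simp [hp] at hd
  · intro h
    refine ⟨node none [R, R, R], [0], by simp [threePlusRoot_iff, children], ?_, rfl⟩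
    rw [degAt_eq (R := R) rfl]
    simp [h]

/-- A rooted subtree can be coloured below some parent if and only if it can be coloured by itself,
provided that its root has three or more children. -/
theorem exists_feas_none_iff {R : RTree} (h : 3 ≤ R.children.length) :
    (∃ c, feas R c none = true) ↔ ∃ c q, feas R c (some q) = true := by
  constructor
  · rintro ⟨c, hc⟩
    obtain rfl | rfl | rfl : c = 0 ∨ c = 1 ∨ c = 2 := by omega
    · rw [feas_zero_iff] at hc
      -- A parent of colour 2 puts no restriction on a vertex of colour 0 or 1.
      exact ⟨0, 2, feas_zero_iff.2 ⟨by decide, hc.2⟩⟩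
    · rw [feas_one_iff] at hc
      exact ⟨1, 2, feas_one_iff.2 ⟨by decide, hc.2⟩⟩
    · rw [feas_two_eq_false (by omega)] at hc
      simp at hc
  · rintro ⟨c, q, hc⟩
    refine ⟨c, ?_⟩
    obtain rfl | rfl | rfl : c = 0 ∨ c = 1 ∨ c = 2 := by omega
    · rw [feas_zero_iff] at hc ⊢
      exact ⟨by simp, hc.2⟩
    · rw [feas_one_iff] at hc ⊢
      exact ⟨by simp, hc.2.1, hc.2.2.1, by have := hc.2.2.2; simp at this ⊢; omega⟩
    · rw [feas_two_eq_false (by omega)] at hc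
      simp at hc

theorem subtreeEquiv_of_feas_eq {R₁ R₂ : RTree}
    (h : ∀ c q, feas R₁ c (some q) = feas R₂ c (some q)) : SubtreeEquiv R₁ R₂ := by
  rintro T p ⟨hT, -, hR⟩ h2
  by_cases hp : p = []
  · subst hp
    obtain rfl : T = R₁ := by simpa [sub?] using hR
    rw [extendable_iff, extendable_iff, exists_feas_none_iff (threePlusRoot_iff.1 hT),
      exists_feas_none_iff (threePlusRoot_iff.1 h2)]
    simp [replaceSubtree, modifyAt, h]
  · rw [extendable_iff, extendable_iff]
    simp only [replaceSubtree, feas_modifyAt hR hp (g := fun _ => R₂) (fun c q => (h c q).symm)]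

/-- A tree with one vertex. -/
abbrev leaf (o : Option (Fin 3)) : RTree := node o []

theorem SubtreeEquiv.extendable_iff_node {R₁ R₂ : RTree} (h : SubtreeEquiv R₁ R₂)
    (h1 : R₁.children.length ≠ 1) (o : Option (Fin 3)) (s t : RTree) :
    (node o [R₁, s, t]).Extendable ↔ (node o [R₂, s, t]).Extendable := by
  refine h (node o [R₁, s, t]) [0] ⟨by simp [threePlusRoot_iff, children], ?_, rfl⟩
    (by simp [replaceSubtree, modifyAt, threePlusRoot_iff, children])
  rw [degAt_eq (R := R₁) rfl]
  simp [h1]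

theorem SubtreeEquiv.extendable_iff_node_node {R₁ R₂ : RTree} (h : SubtreeEquiv R₁ R₂)
    (h1 : R₁.children.length ≠ 1) (o o' : Option (Fin 3)) (s t : RTree) :
    (node o [node o' [R₁], s, t]).Extendable ↔ (node o [node o' [R₂], s, t]).Extendable := by
  refine h (node o [node o' [R₁], s, t]) [0, 0] ⟨by simp [threePlusRoot_iff, children], ?_, rfl⟩
    (by simp [replaceSubtree, modifyAt, threePlusRoot_iff, children])
  rw [degAt_eq (R := R₁) rfl]
  simp [h1]

theorem exists_fin_three {p : Fin 3 → Prop} : (∃ c, p c) ↔ p 0 ∨ p 1 ∨ p 2 := by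
  simp [Fin.exists_fin_succ]

/-- Here the leaf of colour 0 uses up the only neighbour of that colour that the root may have, so
colour 2 is forced on `R`. In the next two tests a vertex of colour 2 with parent 0 or 1 forces the
other of these colours on `R`. The last test yields only a disjunction. -/
theorem extendable_test_two_one (R : RTree) :
    (node (some 1) [R, leaf (some 0), leaf (some 2)]).Extendable ↔ feas R 2 (some 1) = true := by
  rw [extendable_iff, exists_fin_three]
  simp [feas, feasList, fits, NbOk, Fin.forall_fin_succ, feas_self]

theorem extendable_test_one_two (R : RTree) :
    (node (some 0) [node (some 2) [R], leaf none, leaf none]).Extendable ↔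
      feas R 1 (some 2) = true := by
  rw [extendable_iff, exists_fin_three]
  simp [feas, feasList, fits, NbOk, Fin.forall_fin_succ, feas_self]

theorem extendable_test_zero_two (R : RTree) :
    (node (some 1) [node (some 2) [R], leaf (some 2), leaf (some 2)]).Extendable ↔
      feas R 0 (some 2) = true := by
  rw [extendable_iff, exists_fin_three]
  simp [feas, feasList, fits, NbOk, Fin.forall_fin_succ, feas_self]

theorem extendable_test_zero (R : RTree) :
    (node (some 0) [R, leaf (some 1), leaf (some 1)]).Extendable ↔ underZero R = true := by
  rw [extendable_iff, exists_fin_three]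
  simp [feas, feasList, fits, NbOk, Fin.forall_fin_succ, feas_self, underZero]


/-! ### Signatures of rooted subtrees -/

/-- The colours of the root and of its parent that determine all feasible pairs of colours of a
rooted subtree. -/
def subtreeSig (R : RTree) : Bool × Bool × Bool × Bool :=
  (feas R 0 (some 2), feas R 1 (some 2), feas R 1 (some 0), feas R 2 (some 1))

theorem feas_zero_one (R : RTree) : feas R 0 (some 1) = feas R 0 (some 2) := by
  rw [Bool.eq_iff_iff, feas_zero_iff, feas_zero_iff]
  simp

theorem feas_two_zero {R : RTree} (h : R.children.length ≠ 1) :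
    feas R 2 (some 0) = feas R 2 (some 1) := by
  cases R with
  | node o ts =>
    match ts with
    | [] => simp [feas, feasList, NbOk, Fin.forall_fin_succ]
    | [_] => exact (h rfl).elim
    | _ :: _ :: _ =>
      rw [feas_two_eq_false (by simp [children]), feas_two_eq_false (by simp [children])]

/-- The tests see colour 1 below colour 0 only inside the disjunction `underZero`; this recovers it.
If colour 2 is feasible, the root has no children and only its given colour matters; if not, colour
1 is all that is left of the disjunction. -/
theorem feas_one_zero {R : RTree} (h : R.children.length ≠ 1) :
    feas R 1 (some 0) = if feas R 2 (some 1) then feas R 1 (some 2) else underZero R := by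
  rw [underZero, feas_two_zero h]
  cases R with
  | node o ts =>
    match ts with
    | [] =>
      simp only [feas, feasList, NbOk, Fin.forall_fin_succ]
      simp only [Option.toList_some, List.count_singleton]
      simp
      intro h1 h2
      simp [h1] at h2
    | [_] => exact (h rfl).elim
    | _ :: _ :: _ =>
      rw [feas_two_eq_false (P := some 1) (by simp [children])]
      simp

theorem feas_eq_of_subtreeSig_eq {R₁ R₂ : RTree} (h1 : R₁.children.length ≠ 1)
    (h2 : R₂.children.length ≠ 1) (h : subtreeSig R₁ = subtreeSig R₂) (c q : Fin 3) :
    feas R₁ c (some q) = feas R₂ c (some q) := by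
  simp only [subtreeSig, Prod.mk.injEq] at h
  obtain ⟨ha, hb, hc, hd⟩ := h
  by_cases hcq : c = q
  · rw [hcq, feas_self, feas_self]
  · fin_cases c <;> fin_cases q <;> first | exact (hcq rfl).elim | skip
    · exact (feas_zero_one R₁).trans (ha.trans (feas_zero_one R₂).symm)
    · exact ha
    · exact hc
    · exact hb
    · exact (feas_two_zero h1).trans (hd.trans (feas_two_zero h2).symm)
    · exact hd

theorem SubtreeEquiv.subtreeSig_eq {R₁ R₂ : RTree} (h : SubtreeEquiv R₁ R₂)
    (h1 : R₁.children.length ≠ 1) (h2 : R₂.children.length ≠ 1) :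
    subtreeSig R₁ = subtreeSig R₂ := by
  have hd : feas R₁ 2 (some 1) = feas R₂ 2 (some 1) := by
    rw [Bool.eq_iff_iff, ← extendable_test_two_one, ← extendable_test_two_one]
    exact h.extendable_iff_node h1 _ _ _
  have ha : feas R₁ 0 (some 2) = feas R₂ 0 (some 2) := by
    rw [Bool.eq_iff_iff, ← extendable_test_zero_two, ← extendable_test_zero_two]
    exact h.extendable_iff_node_node h1 _ _ _ _
  have hb : feas R₁ 1 (some 2) = feas R₂ 1 (some 2) := by
    rw [Bool.eq_iff_iff, ← extendable_test_one_two, ← extendable_test_one_two]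
    exact h.extendable_iff_node_node h1 _ _ _ _
  have hu : underZero R₁ = underZero R₂ := by
    rw [Bool.eq_iff_iff, ← extendable_test_zero, ← extendable_test_zero]
    exact h.extendable_iff_node h1 _ _ _
  rw [subtreeSig, subtreeSig, feas_one_zero h1, feas_one_zero h2, ha, hb, hd, hu]

theorem subtreeEquiv_iff {R₁ R₂ : RTree} (h1 : R₁.children.length ≠ 1)
    (h2 : R₂.children.length ≠ 1) : SubtreeEquiv R₁ R₂ ↔ subtreeSig R₁ = subtreeSig R₂ :=
  ⟨fun h => h.subtreeSig_eq h1 h2, fun h =>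
    subtreeEquiv_of_feas_eq (feas_eq_of_subtreeSig_eq h1 h2 h)⟩

/-- The subtype is needed: if `R₁` is not a rooted subtree, `SubtreeEquiv R₁ R₂` holds vacuously. -/
theorem equivalence_subtreeEquiv : Equivalence
    (fun R₁ R₂ : {R : RTree // IsRootedSubtree R} => SubtreeEquiv R₁.1 R₂.1) := by
  have h : ∀ R₁ R₂ : {R : RTree // IsRootedSubtree R},
      SubtreeEquiv R₁.1 R₂.1 ↔ subtreeSig R₁.1 = subtreeSig R₂.1 := fun R₁ R₂ =>
    subtreeEquiv_iff (isRootedSubtree_iff.1 R₁.2) (isRootedSubtree_iff.1 R₂.2)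
  simp only [h]
  exact ⟨fun _ => rfl, Eq.symm, Eq.trans⟩

theorem SubtreeClass.length_rep (X : SubtreeClass) : X.rep.children.length ≠ 1 := by
  cases X <;> simp [SubtreeClass.rep, children]

theorem inSubtreeClass_iff {R : RTree} (h : R.children.length ≠ 1) {X : SubtreeClass} :
    InSubtreeClass R X ↔ subtreeSig R = subtreeSig X.rep :=
  subtreeEquiv_iff h X.length_rep

/-! ### Signatures of branches -/

/-- The branch can be coloured with root colour `0`, with root colour `1`, and with root colour `1`
without using a neighbour of colour `0`, respectively. -/
def branchSig (B : Branch) : Bool × Bool × Bool :=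
  (fits B.rootColour 0 && underZero B.top, fits B.rootColour 1 && underOne B.top,
    fits B.rootColour 1 && underOneFree B.top)

/-- By `hP` colour 2 is impossible before and after. For colour 0 the branches are tested one by
one, and for colour 1 one also counts those that need a neighbour of colour 0; both depend on
signatures only. -/
theorem feas_set {R : RTree} {B₁ B₂ : Branch} {i : ℕ} (hc : R.colour = B₁.rootColour)
    (hi : R.children[i]? = some B₁.top) (h : branchSig B₁ = branchSig B₂) (c : Fin 3)
    {P : Option (Fin 3)} (hP : 3 ≤ R.children.length + P.toList.length) :
    feas (node B₂.rootColour (R.children.set i B₂.top)) c P = feas R c P := by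
  simp only [branchSig, Prod.mk.injEq] at h
  obtain ⟨h0, h1, h2⟩ := h
  obtain ⟨l₁, l₂, hl, rfl⟩ : ∃ l₁ l₂, R.children = l₁ ++ B₁.top :: l₂ ∧ l₁.length = i := by
    obtain ⟨hlt, hi⟩ := List.getElem?_eq_some_iff.1 hi
    exact ⟨R.children.take i, R.children.drop (i + 1), by simp [← hi], by simp; omega⟩
  have hset : R.children.set l₁.length B₂.top = l₁ ++ B₂.top :: l₂ := by simp [hl]
  rw [hset]
  obtain rfl | rfl | rfl : c = 0 ∨ c = 1 ∨ c = 2 := by omega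
  · rw [Bool.eq_iff_iff, feas_zero_iff, feas_zero_iff, hl, hc]
    rw [Bool.eq_iff_iff] at h0
    simp only [colour, children, List.forall_mem_append, List.forall_mem_cons,
      Bool.and_eq_true] at h0 ⊢
    tauto
  · rw [Bool.eq_iff_iff, feas_one_iff, feas_one_iff, hl, hc]
    simp only [colour, children, List.forall_mem_append, List.forall_mem_cons,
      List.countP_append, List.countP_cons]
    -- If the root colour of just one branch forbids 1, equal signatures imply that the child in the
    -- other branch forbids it.
    by_cases h3 : fits B₁.rootColour 1 = true <;> by_cases h4 : fits B₂.rootColour 1 = true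
    · simp only [h3, h4, Bool.true_and] at h1 h2 ⊢
      rw [h1, h2]
    · simp only [h3, h4, Bool.true_and, Bool.false_and] at h1 h2 ⊢
      simp [h1]
    · simp only [h3, h4, Bool.true_and, Bool.false_and] at h1 h2 ⊢
      simp [← h1]
    · simp [h3, h4]
  · rw [feas_two_eq_false hP, feas_two_eq_false]
    rw [hl] at hP
    simpa [children] using hP

theorem branchEquiv_of_branchSig_eq {B₁ B₂ : Branch} (h : branchSig B₁ = branchSig B₂) :
    BranchEquiv B₁ B₂ := by
  rintro T p i ⟨R, ⟨hT, hd, hR⟩, hc, hi⟩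
  -- A vertex with a child and of degree other than two has degree at least three, which rules out
  -- colour 2.
  have hlen : 0 < R.children.length := by
    have := (List.getElem?_eq_some_iff.1 hi).1
    omega
  rw [extendable_iff, extendable_iff]
  rw [degAt_eq hR] at hd
  refine exists_congr fun c => ?_
  by_cases hp : p = []
  · subst hp
    obtain rfl : T = R := by simpa [sub?] using hR
    rw [threePlusRoot_iff] at hT
    rw [replaceBranch, modifyAt, feas_set hc hi h c (by omega)]
  · rw [if_neg hp] at hd
    rw [replaceBranch, feas_modifyAt hR hp]
    exact fun c q => feas_set hc hi h c (by simp; omega)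

theorem BranchEquiv.extendable_iff_node {B₁ B₂ : Branch} (h : BranchEquiv B₁ B₂) (s t : RTree) :
    (node B₁.rootColour [B₁.top, s, t]).Extendable ↔
      (node B₂.rootColour [B₂.top, s, t]).Extendable := by
  refine h (node B₁.rootColour [B₁.top, s, t]) [] 0 ⟨_, ⟨?_, ?_, rfl⟩, rfl, rfl⟩
  · simp [threePlusRoot_iff, children]
  · rw [degAt_eq rfl]
    simp [children]

/-- In this and the next two tests the root has three children, so its colour is not 2. Two leaves
of colour 1 force 0. Two children of colour 2 that already have a neighbour of colour 0 force 1 and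
leave the permitted neighbour of colour 0 to `t`. Leaves of colours 0 and 2 force 1 and take that
neighbour away. -/
theorem extendable_branch_zero (o : Option (Fin 3)) (t : RTree) :
    (node o [t, leaf (some 1), leaf (some 1)]).Extendable ↔
      (fits o 0 && underZero t) = true := by
  rw [extendable_iff, exists_fin_three]
  simp [feas, feasList, fits, NbOk, Fin.forall_fin_succ, feas_self, underZero]

theorem extendable_branch_one (o : Option (Fin 3)) (t : RTree) :
    (node o [t, node (some 2) [leaf (some 0)], node (some 2) [leaf (some 0)]]).Extendable ↔
      (fits o 1 && underOne t) = true := by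
  rw [extendable_iff, exists_fin_three]
  simp [feas, feasList, fits, NbOk, Fin.forall_fin_succ, feas_self, underOne]

theorem extendable_branch_one_free (o : Option (Fin 3)) (t : RTree) :
    (node o [t, leaf (some 0), leaf (some 2)]).Extendable ↔
      (fits o 1 && underOneFree t) = true := by
  rw [extendable_iff, exists_fin_three]
  simp [feas, feasList, fits, NbOk, Fin.forall_fin_succ, feas_self, underOneFree]

theorem branchEquiv_iff {B₁ B₂ : Branch} : BranchEquiv B₁ B₂ ↔ branchSig B₁ = branchSig B₂ := by
  refine ⟨fun h => ?_, branchEquiv_of_branchSig_eq⟩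
  simp only [branchSig, Prod.mk.injEq, Bool.eq_iff_iff (b := fits B₂.rootColour _ && _)]
  rw [← extendable_branch_zero, ← extendable_branch_zero, ← extendable_branch_one,
    ← extendable_branch_one, ← extendable_branch_one_free, ← extendable_branch_one_free]
  exact ⟨h.extendable_iff_node _ _, h.extendable_iff_node _ _, h.extendable_iff_node _ _⟩

theorem equivalence_branchEquiv : Equivalence BranchEquiv := by
  have h : BranchEquiv = fun B₁ B₂ => branchSig B₁ = branchSig B₂ := by
    funext B₁ B₂
    exact propext branchEquiv_iff
  rw [h]
  exact ⟨fun _ => rfl, Eq.symm, Eq.trans⟩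

/-! ### The classes -/

/-- The signature of the branches in a class. -/
def BranchClass.sig : BranchClass → Bool × Bool × Bool
  | A => (false, false, false)
  | B => (true, false, false)
  | C => (false, true, false)
  | D => (false, true, true)
  | E => (true, true, false)
  | F => (true, true, true)

theorem BranchClass.branchSig_rep (X : BranchClass) : branchSig X.rep = X.sig := by
  cases X <;> decide

theorem BranchClass.sig_injective : Function.Injective BranchClass.sig := by
  intro X Y
  cases X <;> cases Y <;> decide

theorem inBranchClass_iff {B : Branch} {X : BranchClass} :
    InBranchClass B X ↔ branchSig B = X.sig := by
  rw [InBranchClass, branchEquiv_iff, X.branchSig_rep]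

/-- Two of the eight triples violate `underOne_of_underOneFree`, and the other six are the
signatures of A–F. Thus coloured branches are covered as well. -/
theorem existsUnique_inBranchClass (B : Branch) : ∃! X, InBranchClass B X := by
  have h : ∃ X : BranchClass, branchSig B = X.sig := by
    have := underOne_of_underOneFree (t := B.top)
    rw [branchSig]
    revert this
    generalize (fits B.rootColour 0 && underZero B.top) = x
    generalize underOne B.top = y
    generalize underOneFree B.top = z
    generalize fits B.rootColour 1 = w
    intro h
    cases y <;> cases z <;> cases w <;> cases x <;>
      first
      | exact ⟨.A, rfl⟩
      | exact ⟨.B, rfl⟩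
      | exact ⟨.C, rfl⟩
      | exact ⟨.D, rfl⟩
      | exact ⟨.E, rfl⟩
      | exact ⟨.F, rfl⟩
      | simp at h
  obtain ⟨X, hX⟩ := h
  exact ⟨X, inBranchClass_iff.2 hX, fun Y hY =>
    BranchClass.sig_injective ((inBranchClass_iff.1 hY).symm.trans hX)⟩

theorem BranchClass.eq_of_branchEquiv {X Y : BranchClass} (h : BranchEquiv X.rep Y.rep) :
    X = Y := by
  rw [branchEquiv_iff, X.branchSig_rep, Y.branchSig_rep] at h
  exact sig_injective h

/-- The signature of the rooted subtrees in a class. -/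
def SubtreeClass.sig : SubtreeClass → Bool × Bool × Bool × Bool
  | I => (false, false, false, false)
  | II => (true, false, false, false)
  | III => (false, true, false, false)
  | IV => (false, true, true, false)
  | V => (true, true, false, false)
  | VI => (true, true, true, false)
  | VII => (true, true, true, true)

theorem SubtreeClass.subtreeSig_rep (X : SubtreeClass) : subtreeSig X.rep = X.sig := by
  cases X <;> decide

theorem SubtreeClass.sig_injective : Function.Injective SubtreeClass.sig := by
  intro X Y
  cases X <;> cases Y <;> decide

theorem inSubtreeClass_iff_sig {R : RTree} (h : R.children.length ≠ 1) {X : SubtreeClass} :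
    InSubtreeClass R X ↔ subtreeSig R = X.sig := by
  rw [inSubtreeClass_iff h, X.subtreeSig_rep]

theorem SubtreeClass.eq_of_subtreeEquiv {X Y : SubtreeClass} (h : SubtreeEquiv X.rep Y.rep) :
    X = Y := by
  rw [subtreeEquiv_iff X.length_rep Y.length_rep, X.subtreeSig_rep, Y.subtreeSig_rep] at h
  exact sig_injective h

/-! ### The table for branches -/

/-- The feasible pairs of different colours of the root and its parent. -/
def pairSig (R : RTree) : Bool × Bool × Bool × Bool × Bool × Bool :=
  (feas R 0 (some 1), feas R 0 (some 2), feas R 1 (some 0), feas R 1 (some 2),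
    feas R 2 (some 0), feas R 2 (some 1))

/-- The effect on the feasible pairs of colours of hanging a tree below a new uncoloured root. -/
def pairStep : Bool × Bool × Bool × Bool × Bool × Bool → Bool × Bool × Bool × Bool × Bool × Bool
  | (a, a', b, b', e, e') => (b || e, b || e, e', a || e', b', a')

/-- A new root 0 admits a child 1 or 2. A new root 1 needs a child 2 if its parent is 0, and admits
0 or 2 if its parent is 2. A new root 2 needs as child the colour from `{0, 1}` that its parent
lacks. -/
theorem pairSig_node (R : RTree) : pairSig (node none [R]) = pairStep (pairSig R) := by
  simp [pairSig, pairStep, feas, feasList, fits, NbOk, Fin.forall_fin_succ, feas_self]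

theorem pairSig_chain (k : ℕ) (R : RTree) : pairSig (chain k R) = pairStep^[k] (pairSig R) := by
  induction k with
  | zero => rfl
  | succ k ih => rw [Function.iterate_succ_apply', chain, pairSig_node, ih]

/-- The signature of an uncoloured branch in terms of the feasible pairs of colours. -/
def sigOfPairs : Bool × Bool × Bool × Bool × Bool × Bool → Bool × Bool × Bool
  | (a, _, b, _, e, e') => (b || e, a || e', e')

theorem branchSig_eq_sigOfPairs (R : RTree) :
    branchSig ⟨none, R⟩ = sigOfPairs (pairSig R) := by
  simp [branchSig, fits, underZero, underOne, underOneFree, sigOfPairs, pairSig]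

theorem SubtreeClass.iterate_pairStep_fixed (X : SubtreeClass) :
    pairStep (pairStep^[12] (pairSig X.rep)) = pairStep^[12] (pairSig X.rep) := by
  cases X <;> decide

/-- The shift to `k + 1` arises because `sigOfPairs` accounts for the last edge of the path. -/
theorem SubtreeClass.sigOfPairs_iterate (X : SubtreeClass) (k : ℕ) :
    sigOfPairs (pairStep^[k] (pairSig X.rep)) = (branchTable (k + 1) X).sig := by
  -- By 12 steps all seven orbits have reached a fixed point, and the table is past its last listed
  -- row.
  by_cases hk : k < 12
  · interval_cases k <;> cases X <;> decide
  · obtain ⟨m, rfl⟩ := Nat.exists_eq_add_of_le (not_lt.1 hk)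
    have h1 : branchTable (12 + m + 1) X = branchTable 13 X := by
      rw [show 12 + m + 1 = m + 13 by omega]
      cases X <;> rfl
    rw [h1, Nat.add_comm 12 m, Function.iterate_add_apply,
      Function.iterate_fixed X.iterate_pairStep_fixed]
    cases X <;> decide

theorem branchSig_branchOver {R : RTree} {X : SubtreeClass} (h : pairSig R = pairSig X.rep)
    {d : ℕ} (hd : 1 ≤ d) : branchSig (branchOver R d) = (branchTable d X).sig := by
  obtain ⟨k, rfl⟩ := Nat.exists_eq_add_of_le' hd
  rw [branchOver, branchSig_eq_sigOfPairs, pairSig_chain, h, Nat.add_sub_cancel,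
    X.sigOfPairs_iterate]

theorem InSubtreeClass.pairSig_eq {R : RTree} {X : SubtreeClass} (hR : R.children.length ≠ 1)
    (h : InSubtreeClass R X) : pairSig R = pairSig X.rep := by
  have := feas_eq_of_subtreeSig_eq hR X.length_rep ((inSubtreeClass_iff hR).1 h)
  simp [pairSig, this]

/-! ### The table for rooted subtrees -/

/-- With root colour 1, at most one branch may need a neighbour of colour 0 if the parent has colour
2, and none if the parent has colour 0. Two children and a parent exclude root colour 2. -/
theorem subtreeSig_eq {R : RTree} (h : 2 ≤ R.children.length) :
    subtreeSig R = (R.children.all fun t => (branchSig ⟨R.colour, t⟩).1,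
      R.children.all (fun t => (branchSig ⟨R.colour, t⟩).2.1) &&
        decide (R.children.countP (fun t => !(branchSig ⟨R.colour, t⟩).2.2) ≤ 1),
      R.children.all (fun t => (branchSig ⟨R.colour, t⟩).2.1) &&
        decide (R.children.countP (fun t => !(branchSig ⟨R.colour, t⟩).2.2) = 0),
      false) := by
  obtain ⟨s, ss, hs⟩ : ∃ s ss, R.children = s :: ss := by
    cases hc : R.children with
    | nil => simp [hc] at h
    | cons s ss => exact ⟨s, ss, rfl⟩
  rw [subtreeSig, feas_two_eq_false (by simp; omega)]
  simp only [Prod.mk.injEq, and_true]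
  refine ⟨?_, ?_, ?_⟩ <;> rw [Bool.eq_iff_iff] <;>
    simp only [feas_zero_iff, feas_one_iff, Bool.and_eq_true, List.all_eq_true, decide_eq_true_eq,
      branchSig]
  · by_cases hf : fits R.colour 0 = true
    · simp [hf]
    · simp [hf, hs]
      exact ⟨s, fun h => (h rfl).elim⟩
  · by_cases hf : fits R.colour 1 = true
    · simp [hf]
    · simp [hf, hs]
      exact fun h => ((h s).1 rfl).elim
  · by_cases hf : fits R.colour 1 = true
    · simp [hf]
    · simp [hf, hs]

theorem countP_eq_sum_count (L : List BranchClass) (p : BranchClass → Bool) :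
    L.countP p = (if p .A then L.count .A else 0) + (if p .B then L.count .B else 0) +
      (if p .C then L.count .C else 0) + (if p .D then L.count .D else 0) +
      (if p .E then L.count .E else 0) + (if p .F then L.count .F else 0) := by
  induction L with
  | nil => simp
  | cons X L ih =>
    rw [List.countP_cons, ih]
    cases X <;> simp <;> split_ifs <;> omega

/-- Both sides depend only on the six class counts, so linear arithmetic settles each case of the
table. The empty list must be excluded: it gives VII, whose last entry is `true`. -/
theorem subtreeTable_sig {L : List BranchClass} (hL : L ≠ []) :
    (subtreeTable L).sig = (L.all fun X => X.sig.1,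
      L.all (fun X => X.sig.2.1) && decide (L.countP (fun X => !X.sig.2.2) ≤ 1),
      L.all (fun X => X.sig.2.1) && decide (L.countP (fun X => !X.sig.2.2) = 0), false) := by
  have all_eq : ∀ p : BranchClass → Bool, L.all p = decide (L.countP (fun X => !p X) = 0) := by
    intro p
    rw [Bool.eq_iff_iff]
    simp
  have hlen : L.length = L.countP fun _ => true := by simp
  have hpos := List.length_pos_iff.2 hL
  rw [hlen, countP_eq_sum_count] at hpos
  simp only [all_eq, countP_eq_sum_count, BranchClass.sig, subtreeTable]
  simp only [Bool.not_true, Bool.not_false, if_true, Bool.false_eq_true, if_false] at hpos ⊢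
  split_ifs <;> simp only [SubtreeClass.sig, Prod.mk.injEq, and_true] <;>
    refine ⟨?_, ?_, ?_⟩ <;> rw [Bool.eq_iff_iff] <;> simp only [Bool.and_eq_true,
    decide_eq_true_eq, Bool.false_eq_true, false_iff, true_iff] <;> omega

theorem inSubtreeClass_subtreeTable {R : RTree} {L : List BranchClass}
    (hR : R.children.length ≠ 1) (h0 : R.children = [] → R.colour = none)
    (h : List.Forall₂ (fun t X => branchSig ⟨R.colour, t⟩ = X.sig) R.children L) :
    InSubtreeClass R (subtreeTable L) := by
  rw [inSubtreeClass_iff_sig hR]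
  by_cases hc : R.children = []
  · rw [hc, List.forall₂_nil_left_iff] at h
    obtain rfl : R = node none [] := by
      cases R with
      | node o ts => exact congrArg₂ node (h0 hc) hc
    rw [h]
    decide
  · have hpos := List.length_pos_iff.2 hc
    have hL : L ≠ [] := by
      rintro rfl
      exact hc (List.forall₂_nil_right_iff.1 h)
    rw [subtreeSig_eq (by omega), subtreeTable_sig hL]
    have hmap : R.children.map (fun t => branchSig ⟨R.colour, t⟩) = L.map BranchClass.sig := by
      rwa [← List.forall₂_eq_eq_eq, List.forall₂_map_left_iff, List.forall₂_map_right_iff]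
    have hall : ∀ p : Bool × Bool × Bool → Bool,
        (R.children.all fun t => p (branchSig ⟨R.colour, t⟩)) = L.all fun X => p X.sig := by
      intro p
      simpa [List.all_map, Function.comp_def] using congrArg (fun l => l.all p) hmap
    have hcount : ∀ p : Bool × Bool × Bool → Bool,
        (R.children.countP fun t => p (branchSig ⟨R.colour, t⟩)) = L.countP fun X => p X.sig := by
      intro p
      simpa [List.countP_map, Function.comp_def] using congrArg (fun l => l.countP p) hmap
    rw [hall fun s => s.1, hall fun s => s.2.1, hcount fun s => !s.2.2]


/-! ### The tables applied from the bottom up -/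

theorem uncoloured_node {o : Option (Fin 3)} {ts : List RTree} :
    (node o ts).Uncoloured ↔ o = none ∧ ∀ t ∈ ts, t.Uncoloured := by
  constructor
  · intro h
    refine ⟨h [], fun t ht p => ?_⟩
    obtain ⟨i, hi⟩ := List.mem_iff_getElem?.1 ht
    simpa [colourAt, sub?, children, hi] using h (i :: p)
  · rintro ⟨rfl, h⟩ p
    cases p with
    | nil => rfl
    | cons i p =>
      simp only [colourAt, sub?, children]
      cases hi : ts[i]? with
      | none => rfl
      | some t => exact h t (List.mem_iff_getElem?.2 ⟨i, hi⟩) p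

theorem chain_node_singleton (k : ℕ) (t : RTree) : chain k (node none [t]) = chain (k + 1) t := by
  induction k with
  | zero => rfl
  | succ k ih => exact congrArg (fun s => node none [s]) ih

-- A vertex with a single child is not the root of a rooted subtree; it is absorbed into the path,
-- whose length `d` grows by one.
mutual
theorem branchSig_branchOver_eq_table : ∀ (t : RTree) (d : ℕ), t.Uncoloured → 1 ≤ d →
    branchSig (branchOver t d) = (tableBranchClass t d).sig
  | node o [], d, ht, hd => by
    obtain ⟨rfl, -⟩ := uncoloured_node.1 ht
    rw [tableBranchClass]
    refine branchSig_branchOver (InSubtreeClass.pairSig_eq (by simp [children]) ?_) hd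
    exact inSubtreeClass_subtreeTable (by simp [children]) (fun _ => rfl) List.Forall₂.nil
  | node o [t], d, ht, hd => by
    obtain ⟨rfl, h⟩ := uncoloured_node.1 ht
    rw [tableBranchClass, ← branchSig_branchOver_eq_table t (d + 1) (h t (by simp)) (by omega),
      branchOver, branchOver, chain_node_singleton, Nat.sub_add_cancel hd, Nat.add_sub_cancel]
  | node o (t₁ :: t₂ :: ts), d, ht, hd => by
    obtain ⟨rfl, h⟩ := uncoloured_node.1 ht
    rw [tableBranchClass]
    refine branchSig_branchOver (InSubtreeClass.pairSig_eq (by simp [children]) ?_) hd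
    exact inSubtreeClass_subtreeTable (by simp [children]) (fun _ => rfl)
      (.cons (branchSig_branchOver_eq_table t₁ 1 (h _ (by simp)) le_rfl)
        (.cons (branchSig_branchOver_eq_table t₂ 1 (h _ (by simp)) le_rfl)
          (forall₂_tableBranchClasses ts fun t ht => h t (by simp [ht]))))
theorem forall₂_tableBranchClasses : ∀ ts : List RTree, (∀ t ∈ ts, t.Uncoloured) →
    List.Forall₂ (fun t X => branchSig ⟨none, t⟩ = X.sig) ts (tableBranchClasses ts)
  | [], _ => by
    rw [tableBranchClasses]
    exact .nil
  | t :: ts, h => by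
    rw [tableBranchClasses]
    exact .cons (branchSig_branchOver_eq_table t 1 (h t (by simp)) le_rfl)
      (forall₂_tableBranchClasses ts fun s hs => h s (by simp [hs]))
end

theorem inSubtreeClass_tableClass {R : RTree} (hR : R.children.length ≠ 1) (h : R.Uncoloured) :
    InSubtreeClass R (tableClass R) := by
  cases R with
  | node o ts =>
    obtain ⟨rfl, h'⟩ := uncoloured_node.1 h
    exact inSubtreeClass_subtreeTable hR (fun _ => rfl) (forall₂_tableBranchClasses ts h')

theorem extendable_iff_rsColourable {T : RTree} (h : T.Uncoloured) :
    T.Extendable ↔ RSColourable T.graph 3 :=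
  exists_congr fun f => and_iff_left fun x c hc => by simp [h x.1] at hc

/-- Class I is the only class without a feasible pair. -/
theorem rsColourable_iff_tableClass {T : RTree} (hT : T.ThreePlusRoot) (h : T.Uncoloured) :
    RSColourable T.graph 3 ↔ tableClass T ≠ .I := by
  rw [threePlusRoot_iff] at hT
  have hlen : T.children.length ≠ 1 := by omega
  have hc := inSubtreeClass_tableClass hlen h
  have hfeas := feas_eq_of_subtreeSig_eq hlen (SubtreeClass.length_rep _)
    ((inSubtreeClass_iff hlen).1 hc)
  rw [← extendable_iff_rsColourable h, extendable_iff, exists_feas_none_iff hT]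
  simp only [hfeas]
  cases tableClass T <;> decide

/-! ### Removing leaves one by one -/

/-- The possible local situations at a vertex: its colour, together with the colours lower than its
own among the neighbours that have been removed. -/
abbrev PeelState : Type := Set (Fin 3 × Finset (Fin 3))

/-- The situation at a vertex none of whose neighbours has been removed. -/
def PeelState.fresh : PeelState := {x | x.2 = ∅}

/-- The situation at a vertex with the situation `Su` after removing an adjacent leaf with the
situation `Sv`. -/
def PeelState.merge (Su Sv : PeelState) : PeelState :=
  {x | ∃ U d W, (x.1, U) ∈ Su ∧ (d, W) ∈ Sv ∧ d ≠ x.1 ∧ (x.1 < d → x.1 ∉ W ∧ x.2 = U) ∧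
    (d < x.1 → d ∉ U ∧ x.2 = insert d U)}

/-- The vertices in `R` can be coloured in accordance with the situations `A`. -/
def PeelSolvable {V : Type} (G : SimpleGraph V) (R : Finset V) (A : V → PeelState) : Prop :=
  ∃ (f : V → Fin 3) (U : V → Finset (Fin 3)), (∀ x ∈ R, (f x, U x) ∈ A x) ∧
    (∀ x ∈ R, ∀ y ∈ R, G.Adj x y → f x ≠ f y ∧ (f y < f x → f y ∉ U x)) ∧
    ∀ x ∈ R, ∀ y ∈ R, ∀ z ∈ R, G.Adj x y → G.Adj y z → x ≠ z → f x = f z → ¬ f x < f y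

theorem peelSolvable_univ {V : Type} [Fintype V] (G : SimpleGraph V) :
    PeelSolvable G Finset.univ (fun _ => PeelState.fresh) ↔ RSColourable G 3 := by
  constructor
  · rintro ⟨f, U, -, h1, h2⟩
    exact ⟨f, fun x y h => (h1 x (Finset.mem_univ x) y (Finset.mem_univ y) h).1,
      fun x y z => h2 x (Finset.mem_univ x) y (Finset.mem_univ y) z (Finset.mem_univ z)⟩
  · rintro ⟨f, h1, h2⟩
    exact ⟨f, fun _ => ∅, fun x _ => rfl, fun x _ y _ h => ⟨h1 x y h, by simp⟩,
      fun x _ y _ z _ => h2 x y z⟩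

theorem peelSolvable_singleton {V : Type} (G : SimpleGraph V) (r : V) (A : V → PeelState) :
    PeelSolvable G {r} A ↔ A r ≠ ∅ := by
  rw [← Set.nonempty_iff_ne_empty]
  constructor
  · rintro ⟨f, U, h, -⟩
    exact ⟨_, h r (by simp)⟩
  · rintro ⟨⟨c, U⟩, h⟩
    refine ⟨fun _ => c, fun _ => U, by simpa using h, ?_, ?_⟩
    · simp
    · simp

/-- The leaf `v` meets the rest only at `u`. If the colour of `v` is the lower one, it becomes a
colour that no other neighbour of `u` may repeat; if it is the higher one, the colour of `u` must be
new among the lower colours recorded at `v`. -/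
theorem peelSolvable_insert {V : Type} [DecidableEq V] {G : SimpleGraph V} {R : Finset V}
    {A : V → PeelState} {u v : V} (hu : u ∈ R) (hv : v ∉ R)
    (huv : ∀ x ∈ R, G.Adj v x ↔ x = u) :
    PeelSolvable G (insert v R) A ↔
      PeelSolvable G R (Function.update A u ((A u).merge (A v))) := by
  have hadj : G.Adj v u := (huv u hu).2 rfl
  have hne : u ≠ v := fun h => hv (h ▸ hu)
  have hneR : ∀ x ∈ R, x ≠ v := fun x hx h => hv (h ▸ hx)
  constructor
  · rintro ⟨f, U, h1, h2, h3⟩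
    have hvi : v ∈ insert v R := Finset.mem_insert_self v R
    have hmem : ∀ {x}, x ∈ R → x ∈ insert v R := fun h => Finset.mem_insert_of_mem h
    refine ⟨f, Function.update U u (if f v < f u then insert (f v) (U u) else U u),
      fun x hx => ?_, fun x hx y hy hxy => ⟨(h2 x (hmem hx) y (hmem hy) hxy).1, fun hlt => ?_⟩,
      fun x hx y hy z hz => h3 x (hmem hx) y (hmem hy) z (hmem hz)⟩
    · by_cases hxu : x = u
      · subst hxu
        simp only [Function.update_self]
        refine ⟨U x, f v, U v, h1 x (hmem hx), h1 v hvi, (h2 v hvi x (hmem hx) hadj).1,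
          fun hlt => ⟨(h2 v hvi x (hmem hx) hadj).2 hlt, if_neg hlt.asymm⟩, fun hlt =>
          ⟨(h2 x (hmem hx) v hvi hadj.symm).2 hlt, if_pos hlt⟩⟩
      · simpa [Function.update_of_ne hxu] using h1 x (hmem hx)
    · have hold := (h2 x (hmem hx) y (hmem hy) hxy).2 hlt
      by_cases hxu : x = u
      · subst hxu
        simp only [Function.update_self]
        split_ifs with hvx
        · rw [Finset.mem_insert, not_or]
          refine ⟨fun he => ?_, hold⟩
          exact h3 v hvi x (hmem hx) y (hmem hy) hadj hxy (hneR y hy).symm he.symm hvx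
        · exact hold
      · simpa [Function.update_of_ne hxu] using hold
  · rintro ⟨f, U, h1, h2, h3⟩
    have hu1 := h1 u hu
    rw [Function.update_self] at hu1
    obtain ⟨U₀, d, W, hU, hW, hd, hlt, hgt⟩ := hu1
    simp only at hU hd hlt hgt
    -- Putting `v` back can only shrink the set of colours recorded at `u`, so the old constraints
    -- persist.
    have hsub : U₀ ⊆ U u := by
      rcases lt_or_gt_of_ne hd with h | h
      · rw [(hgt h).2]
        exact Finset.subset_insert _ _
      · rw [(hlt h).2]
    have hfv : Function.update f v d v = d := Function.update_self ..
    have hfR : ∀ x ∈ R, Function.update f v d x = f x := fun x hx =>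
      Function.update_of_ne (hneR x hx) ..
    have hUv : Function.update (Function.update U u U₀) v W v = W := Function.update_self ..
    have hUR : ∀ x ∈ R, Function.update (Function.update U u U₀) v W x
        = if x = u then U₀ else U x := by
      intro x hx
      rw [Function.update_of_ne (hneR x hx), Function.update_apply]
    -- This excludes the forbidden paths `v, u, z`: a low colour `d` of `v` is recorded at `u`.
    have hpath : ∀ z ∈ R, G.Adj u z → d = f z → ¬ d < f u := by
      intro z hz huz hdz hdu
      have := (h2 u hu z hz huz).2 (hdz ▸ hdu)
      rw [(hgt hdu).2, ← hdz] at this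
      simp at this
    refine ⟨Function.update f v d, Function.update (Function.update U u U₀) v W,
      fun x hx => ?_, fun x hx' y hy' hxy => ?_, fun x hx' y hy' z hz' hxy hyz hxz => ?_⟩
    · rcases Finset.mem_insert.1 hx with rfl | hx
      · rw [hfv, hUv]
        exact hW
      · rw [hfR x hx, hUR x hx]
        split_ifs with hxu
        · rw [hxu]
          exact hU
        · simpa [Function.update_of_ne hxu] using h1 x hx
    · rcases Finset.mem_insert.1 hx' with hx | hx <;> rcases Finset.mem_insert.1 hy' with hy | hy
      · exact (hxy.ne (hx.trans hy.symm)).elim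
      · subst hx
        obtain rfl := (huv y hy).1 hxy
        rw [hfv, hUv, hfR y hy]
        exact ⟨hd, fun h => (hlt h).1⟩
      · subst hy
        obtain rfl := (huv x hx).1 hxy.symm
        rw [hfv, hUR x hx, hfR x hx, if_pos rfl]
        exact ⟨hd.symm, fun h => (hgt h).1⟩
      · rw [hfR x hx, hfR y hy, hUR x hx]
        refine ⟨(h2 x hx y hy hxy).1, fun h => ?_⟩
        have := (h2 x hx y hy hxy).2 h
        split_ifs with hxu
        · exact fun hm => this (hxu ▸ hsub hm)
        · exact this
    · rcases Finset.mem_insert.1 hy' with hy | hy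
      · subst hy
        have hx := (Finset.mem_insert.1 hx').resolve_left hxy.ne
        have hz := (Finset.mem_insert.1 hz').resolve_left hyz.ne.symm
        exact (hxz (((huv x hx).1 hxy.symm).trans ((huv z hz).1 hyz).symm)).elim
      · rw [hfR y hy]
        rcases Finset.mem_insert.1 hx' with hx | hx <;> rcases Finset.mem_insert.1 hz' with hz | hz
        · exact (hxz (hx.trans hz.symm)).elim
        · subst hx
          obtain rfl := (huv y hy).1 hxy
          rw [hfv, hfR z hz]
          exact hpath z hz hyz
        · subst hz
          obtain rfl := (huv y hy).1 hyz.symm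
          rw [hfv, hfR x hx]
          exact fun h => h ▸ hpath x hx hxy.symm h.symm
        · rw [hfR x hx, hfR z hz]
          exact h3 x hx y hy z hz hxy hyz hxz

/-! ### Search orders of trees -/

/-- The list starts with a vertex of value `0`, and every later vertex `w` is adjacent to the
earlier vertex with value `par w`. -/
inductive SearchOrder {n : ℕ} (G : SimpleGraph (Fin n)) (par : ℕ → ℕ) : List (Fin n) → Prop
  | single (r : Fin n) : r.val = 0 → SearchOrder G par [r]
  | snoc (q : List (Fin n)) (u w : Fin n) : SearchOrder G par q → u ∈ q → w ∉ q → G.Adj u w →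
      par w = u → SearchOrder G par (q ++ [w])

namespace SearchOrder

variable {n : ℕ} {G : SimpleGraph (Fin n)} {par : ℕ → ℕ} {q : List (Fin n)}

/-- The search writes parents only for newly found vertices. -/
theorem congr {par' : ℕ → ℕ} (h : SearchOrder G par q) (hp : ∀ x ∈ q, par' x = par x) :
    SearchOrder G par' q := by
  induction h with
  | single r hr => exact single r hr
  | snoc q u w _ hu hw huw hpar ih =>
    exact snoc q u w (ih fun x hx => hp x (by simp [hx])) hu hw huw
      ((hp w (by simp)).trans hpar)

theorem nodup (h : SearchOrder G par q) : q.Nodup := by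
  induction h with
  | single r hr => simp
  | snoc q u w _ hu hw huw hpar ih =>
    rw [List.nodup_append]
    exact ⟨ih, by simp, fun a ha b hb => by
      obtain rfl := List.mem_singleton.1 hb
      exact fun h => hw (h ▸ ha)⟩

theorem exists_walk_to_root (h : SearchOrder G par q) :
    ∃ r ∈ q, ∀ x ∈ q, ∃ p : G.Walk x r, ∀ y ∈ p.support, y ∈ q := by
  induction h with
  | single r hr =>
    refine ⟨r, by simp, fun x hx => ?_⟩
    obtain rfl := List.mem_singleton.1 hx
    exact ⟨.nil, by simp⟩
  | snoc q u w _ hu hw huw hpar ih =>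
    obtain ⟨r, hr, h⟩ := ih
    refine ⟨r, by simp [hr], fun x hx => ?_⟩
    rcases List.mem_append.1 hx with hx | hx
    · obtain ⟨p, hp⟩ := h x hx
      exact ⟨p, fun y hy => by simp [hp y hy]⟩
    · obtain rfl := List.mem_singleton.1 hx
      obtain ⟨p, hp⟩ := h u hu
      refine ⟨.cons huw.symm p, fun y hy => ?_⟩
      rw [SimpleGraph.Walk.support_cons, List.mem_cons] at hy
      rcases hy with rfl | hy
      · simp
      · simp [hp y hy]

/-- A second neighbour `x` of `w` in `q` would be joined to `u` by a path inside `q` and by another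
through `w`. Read backwards, the last vertex of a search order is thus a leaf. -/
theorem adj_iff (h : SearchOrder G par q) (hG : G.IsAcyclic) {u w : Fin n} (hu : u ∈ q)
    (hw : w ∉ q) (huw : G.Adj u w) {x : Fin n} (hx : x ∈ q) : G.Adj w x ↔ x = u := by
  refine ⟨fun hwx => ?_, fun h => h ▸ huw.symm⟩
  by_contra hxu
  obtain ⟨r, -, h⟩ := h.exists_walk_to_root
  obtain ⟨p₁, h₁⟩ := h x hx
  obtain ⟨p₂, h₂⟩ := h u hu
  have hp : ∀ y ∈ (p₁.append p₂.reverse).toPath.1.support, y ∈ q := by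
    intro y hy
    have := SimpleGraph.Walk.support_toPath_subset_support _ hy
    rw [SimpleGraph.Walk.mem_support_append_iff, SimpleGraph.Walk.support_reverse,
      List.mem_reverse] at this
    exact this.elim (h₁ y) (h₂ y)
  have hq : (SimpleGraph.Walk.cons hwx.symm (.cons huw.symm .nil)).IsPath := by
    rw [SimpleGraph.Walk.isPath_def]
    simp [hwx.ne.symm, hxu, huw.ne.symm]
  have heq := (hG.subsingleton_path x u).elim (p₁.append p₂.reverse).toPath ⟨_, hq⟩
  rw [heq] at hp
  exact hw (hp w (by simp))

theorem eq_of_closed (h : SearchOrder G par q) (hG : G.Connected)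
    (hc : ∀ x ∈ q, ∀ y, G.Adj x y → y ∈ q) (x : Fin n) : x ∈ q := by
  obtain ⟨r, hr, -⟩ := h.exists_walk_to_root
  obtain ⟨p⟩ := hG.preconnected r x
  clear h
  induction p with
  | nil => exact hr
  | cons hadj p ih => exact ih (hc _ hr _ hadj)

end SearchOrder

/-! ### Reasoning about programs -/

/-- The program `p`, started with memory `m`, halts after at most `T` steps with a memory that
satisfies `Q`. -/
def Runs (p : Prog) (m : Mem) (T : ℕ) (Q : Mem → Prop) : Prop :=
  ∃ t m', Exec p m t m' ∧ t ≤ T ∧ Q m'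

theorem Mem.reg_setReg (m : Mem) (x k r : ℕ) :
    (m.setReg x k).reg r = if r = x then k else m.reg r :=
  Function.update_apply ..

theorem Mem.arr_setReg (m : Mem) (x k : ℕ) : (m.setReg x k).arr = m.arr := rfl

theorem Mem.reg_setArr (m : Mem) (a j k : ℕ) : (m.setArr a j k).reg = m.reg := rfl

theorem Mem.arr_setArr (m : Mem) (a j k a' j' : ℕ) :
    (m.setArr a j k).arr a' j' = if a' = a ∧ j' = j then k else m.arr a' j' := by
  simp only [setArr, Function.update_apply]
  split_ifs <;> simp_all

namespace Runs

variable {p q : Prog} {m : Mem} {T T₁ T₂ : ℕ} {Q Q' : Mem → Prop} {b : Test} {x y k a : ℕ}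

theorem mono (h : Runs p m T₁ Q) (hT : T₁ ≤ T₂) (hQ : ∀ m', Q m' → Q' m') : Runs p m T₂ Q' := by
  obtain ⟨t, m', h1, h2, h3⟩ := h
  exact ⟨t, m', h1, h2.trans hT, hQ m' h3⟩

theorem const (h : Q (m.setReg x k)) : Runs (.const x k) m 1 Q := ⟨1, _, .const .., le_rfl, h⟩

theorem copy (h : Q (m.setReg x (m.reg y))) : Runs (.copy x y) m 1 Q := ⟨1, _, .copy .., le_rfl, h⟩

theorem inc (h : Q (m.setReg x (m.reg x + 1))) : Runs (.inc x) m 1 Q := ⟨1, _, .inc .., le_rfl, h⟩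

theorem dec (h : Q (m.setReg x (m.reg x - 1))) : Runs (.dec x) m 1 Q := ⟨1, _, .dec .., le_rfl, h⟩

theorem load (h : Q (m.setReg x (m.arr a (m.reg y)))) : Runs (.load x a y) m 1 Q :=
  ⟨1, _, .load .., le_rfl, h⟩

theorem store (h : Q (m.setArr a (m.reg y) (m.reg x))) : Runs (.store a y x) m 1 Q :=
  ⟨1, _, .store .., le_rfl, h⟩

theorem seq (h : Runs p m T₁ fun m' => Runs q m' T₂ Q) : Runs (.seq p q) m (T₁ + T₂) Q := by
  obtain ⟨t₁, m₁, h1, h2, t₂, m₂, h3, h4, h5⟩ := h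
  exact ⟨_, _, .seq h1 h3, by omega, h5⟩

theorem cond (h1 : b.Holds m → Runs p m T Q) (h2 : ¬ b.Holds m → Runs q m T Q) :
    Runs (.cond b p q) m (T + 1) Q := by
  by_cases hb : b.Holds m
  · obtain ⟨t, m', h3, h4, h5⟩ := h1 hb
    exact ⟨_, _, .condTrue hb h3, by omega, h5⟩
  · obtain ⟨t, m', h3, h4, h5⟩ := h2 hb
    exact ⟨_, _, .condFalse hb h3, by omega, h5⟩

/-- A loop with an invariant `I`, which depends on a potential that pays for the iterations. -/
theorem loop {I : ℕ → Mem → Prop}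
    (h : ∀ φ m, I φ m → b.Holds m →
      ∃ T, Runs p m T fun m' => ∃ φ', T + 1 + φ' ≤ φ ∧ I φ' m') {φ : ℕ} (hI : I φ m) :
    Runs (.loop b p) m (φ + 1) fun m' => ∃ φ', I φ' m' ∧ ¬ b.Holds m' := by
  induction φ using Nat.strong_induction_on generalizing m with
  | _ φ ih =>
    by_cases hb : b.Holds m
    · obtain ⟨T, t₁, m₁, h1, h2, φ', h3, h4⟩ := h φ m hI hb
      obtain ⟨t₂, m₂, h5, h6, h7⟩ := ih φ' (by omega) h4
      exact ⟨_, _, .loopTrue hb h1 h5, by omega, h7⟩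
    · exact ⟨_, _, .loopFalse hb, by omega, φ, hI, hb⟩

end Runs

/-- The program that writes `F i j` to register `8` if the contents `i`, `j` of the registers `4`
and `5` are in the list. -/
def lookupProg (F : ℕ → ℕ → ℕ) : List (ℕ × ℕ) → Prog
  | [] => .const 8 0
  | e :: l => .seq (.const 10 e.1) (.seq (.const 11 e.2) (.cond (.eq 4 10)
      (.cond (.eq 5 11) (.const 8 (F e.1 e.2)) (lookupProg F l)) (lookupProg F l)))

theorem runs_lookupProg (F : ℕ → ℕ → ℕ) {l : List (ℕ × ℕ)} {m : Mem}
    (hm : (m.reg 4, m.reg 5) ∈ l) :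
    Runs (lookupProg F l) m (4 * l.length + 1) fun m' => m'.arr = m.arr ∧
      (∀ r < 8, m'.reg r = m.reg r) ∧ m'.reg 8 = F (m.reg 4) (m.reg 5) := by
  -- Membership moves into the postcondition, since it may fail for the tail of the list.
  suffices h : ∀ l : List (ℕ × ℕ), ∀ m : Mem,
      Runs (lookupProg F l) m (4 * l.length + 1) fun m' => m'.arr = m.arr ∧
        (∀ r < 8, m'.reg r = m.reg r) ∧
        ((m.reg 4, m.reg 5) ∈ l → m'.reg 8 = F (m.reg 4) (m.reg 5)) from
    (h l m).mono le_rfl fun m' h => ⟨h.1, h.2.1, h.2.2 hm⟩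
  intro l
  induction l with
  | nil =>
    intro m
    refine .const ⟨rfl, fun r hr => ?_, by simp⟩
    rw [Mem.reg_setReg, if_neg (by omega)]
  | cons e l ih =>
    intro m
    have hrest : ((m.reg 4, m.reg 5) ≠ e) →
        Runs (lookupProg F l) ((m.setReg 10 e.1).setReg 11 e.2) (4 * l.length + 1) fun m' =>
          m'.arr = m.arr ∧ (∀ r < 8, m'.reg r = m.reg r) ∧
          ((m.reg 4, m.reg 5) ∈ e :: l → m'.reg 8 = F (m.reg 4) (m.reg 5)) := by
      intro hne
      refine (ih _).mono le_rfl fun m' h => ⟨h.1, fun r hr => ?_, fun hmem => ?_⟩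
      · rw [h.2.1 r hr]
        rw [Mem.reg_setReg, if_neg (by omega), Mem.reg_setReg, if_neg (by omega)]
      · have := h.2.2
        simp only [Mem.setReg, Function.update_apply] at this
        exact this ((List.mem_cons.1 hmem).resolve_left hne)
    have : 4 * (e :: l).length + 1 = 1 + (1 + ((4 * l.length + 1 + 1) + 1)) := by
      simp only [List.length_cons]
      omega
    rw [this]
    refine .seq (.const (.seq (.const (.cond (fun h1 => .cond (fun h2 => ?_) fun h2 => ?_)
      fun h1 => ?_))))
    · simp [Test.Holds, Mem.reg_setReg] at h1 h2
      refine Runs.mono (T₁ := 1) (.const ?_) (by omega) fun _ => id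
      refine ⟨rfl, fun r hr => ?_, fun _ => ?_⟩
      · simp only [Mem.reg_setReg]
        rw [if_neg (by omega), if_neg (by omega), if_neg (by omega)]
      · simp [Mem.reg_setReg, h1, h2]
    · refine hrest fun he => h2 ?_
      simp [Test.Holds, Mem.reg_setReg, ← he]
    · refine (hrest fun he => h1 ?_).mono (by omega) fun _ => id
      simp [Test.Holds, Mem.reg_setReg, ← he]

/-- The pairs of numbers up to `N`. -/
def pairsUpTo (N : ℕ) : List (ℕ × ℕ) := List.range (N + 1) ×ˢ List.range (N + 1)

theorem mem_pairsUpTo {N i j : ℕ} (hi : i ≤ N) (hj : j ≤ N) : (i, j) ∈ pairsUpTo N := by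
  exact List.pair_mem_product.2 ⟨List.mem_range.2 (by omega), List.mem_range.2 (by omega)⟩

/-! ### The input -/

section Input

variable {n : ℕ} (adj : Fin n → List (Fin n))

/-- The index at which the neighbour list of vertex `k` starts. -/
def listStart (k : ℕ) : ℕ := (((List.finRange n).take k).flatMap adj).length

theorem inputMem_arr_zero {k : ℕ} (hk : k ≤ n) : (inputMem adj).arr 0 k = listStart adj k := by
  simp [inputMem, listStart, hk]

theorem finRange_eq_take_append (v : Fin n) : List.finRange n =
    (List.finRange n).take v ++ v :: (List.finRange n).drop (v + 1) := by
  conv_lhs => rw [← List.take_append_drop v (List.finRange n)]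
  rw [List.drop_eq_getElem_cons (by simp)]
  simp

theorem listStart_succ (v : Fin n) :
    listStart adj (v + 1) = listStart adj v + (adj v).length := by
  unfold listStart
  rw [List.take_succ_eq_append_getElem (by simp)]
  simp

theorem inputMem_arr_one (v : Fin n) {i : ℕ} {w : Fin n} (h : (adj v)[i]? = some w) :
    (inputMem adj).arr 1 (listStart adj v + i) = w := by
  have hi := (List.getElem?_eq_some_iff.1 h).1
  simp only [inputMem, one_ne_zero, if_false, if_true]
  conv_lhs => rw [finRange_eq_take_append v]
  rw [List.flatMap_append, List.flatMap_cons, List.getElem?_append_right (by simp [listStart]),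
    show listStart adj v + i - _ = i by simp [listStart], List.getElem?_append_left hi, h]
  rfl

end Input

/-! ### Searching the tree -/

/-- The search has found the vertices `q`: array `2` lists them, register `2` holds their number,
array `3` holds the parents, array `4` marks the vertices found, and array `5` is still unused. -/
structure Queue {n : ℕ} (G : SimpleGraph (Fin n)) (adj : Fin n → List (Fin n)) (m : Mem)
    (q : List (Fin n)) : Prop where
  tail : m.reg 2 = q.length
  one : m.reg 7 = 1
  entry : ∀ (i : ℕ) (w : Fin n), q[i]? = some w → m.arr 2 i = w
  mark : ∀ w : Fin n, m.arr 4 w = if w ∈ q then 1 else 0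
  order : SearchOrder G (m.arr 3) q
  starts : m.arr 0 = (inputMem adj).arr 0
  lists : m.arr 1 = (inputMem adj).arr 1
  unused : ∀ w : ℕ, m.arr 5 w = 0

namespace Queue

variable {n : ℕ} {G : SimpleGraph (Fin n)} {adj : Fin n → List (Fin n)} {m m' : Mem}
  {q : List (Fin n)}

theorem congr (h : Queue G adj m q) (ha : m'.arr = m.arr) (h2 : m'.reg 2 = m.reg 2)
    (h7 : m'.reg 7 = m.reg 7) : Queue G adj m' q where
  tail := h2.trans h.tail
  one := h7.trans h.one
  entry := ha ▸ h.entry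
  mark := ha ▸ h.mark
  order := ha ▸ h.order
  starts := ha ▸ h.starts
  lists := ha ▸ h.lists
  unused := ha ▸ h.unused

theorem push (h : Queue G adj m q) {v w : Fin n} (hv : v ∈ q) (hw : w ∉ q) (hvw : G.Adj v w)
    (ha : m'.arr = (((m.setArr 4 w 1).setArr 3 w v).setArr 2 q.length w).arr)
    (h2 : m'.reg 2 = q.length + 1) (h7 : m'.reg 7 = 1) : Queue G adj m' (q ++ [w]) where
  tail := by simp [h2]
  one := h7
  entry i x hx := by
    rw [ha]
    simp only [Mem.arr_setArr]
    by_cases hi : i = q.length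
    · subst hi
      simp only [List.getElem?_concat_length, Option.some.injEq] at hx
      simp [hx]
    · have hlt := (List.getElem?_eq_some_iff.1 hx).1
      simp only [List.length_append, List.length_singleton] at hlt
      rw [List.getElem?_append_left (by omega)] at hx
      simpa [hi] using h.entry i x hx
  mark x := by
    rw [ha]
    simp only [Mem.arr_setArr, List.mem_append, List.mem_singleton]
    by_cases hx : x = w
    · simp [hx]
    · simpa [hx, Fin.val_inj] using h.mark x
  order := by
    refine .snoc q v w (h.order.congr fun x hx => ?_) hv hw hvw ?_
    · have : x ≠ w := fun he => hw (he ▸ hx)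
      rw [ha]
      simp [Mem.arr_setArr, Fin.val_inj, this]
    · rw [ha]
      simp [Mem.arr_setArr]
  starts := by
    rw [← h.starts, ha]
    funext i
    simp [Mem.arr_setArr]
  lists := by
    rw [← h.lists, ha]
    funext i
    simp [Mem.arr_setArr]
  unused x := by
    rw [← h.unused x, ha]
    simp [Mem.arr_setArr]

end Queue

/-- The program that reads one neighbour of the vertex in register `3`. -/
def scanStep : Prog :=
  .seq (.load 6 1 4) (.seq (.load 8 4 6) (.seq
    (.cond (.lt 8 7) (.seq (.store 4 6 7) (.seq (.store 3 6 3) (.seq (.store 2 2 6) (.inc 2))))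
      (.const 8 0)) (.inc 4)))

theorem runs_scan {n : ℕ} {G : SimpleGraph (Fin n)} {adj : Fin n → List (Fin n)}
    (hadj : IsAdjList G adj) {m : Mem} {q : List (Fin n)} {v : Fin n} (hq : Queue G adj m q)
    (hv : v ∈ q) (h3 : m.reg 3 = v) (h4 : m.reg 4 = listStart adj v)
    (h5 : m.reg 5 = listStart adj v + (adj v).length) :
    Runs (.loop (.lt 4 5) scanStep) m (9 * (adj v).length + 1) fun m' => ∃ new,
      Queue G adj m' (q ++ new) ∧ m'.reg 1 = m.reg 1 ∧ ∀ w, G.Adj v w → w ∈ q ++ new := by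
  -- The lists `l₁` and `l₂` are the neighbours read and unread. Each unread one pays 9: at most 8
  -- steps of `scanStep` and one loop test.
  set I : ℕ → Mem → Prop := fun φ m' => ∃ l₁ l₂ new, adj v = l₁ ++ l₂ ∧
    Queue G adj m' (q ++ new) ∧ m'.reg 1 = m.reg 1 ∧ m'.reg 3 = v ∧
    m'.reg 4 = listStart adj v + l₁.length ∧ m'.reg 5 = listStart adj v + (adj v).length ∧
    (∀ w ∈ l₁, w ∈ q ++ new) ∧ φ = 9 * l₂.length with hI
  have hloop := Runs.loop (b := .lt 4 5) (p := scanStep) (I := I) (m := m)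
    (φ := 9 * (adj v).length) ?_ ?_
  · refine hloop.mono le_rfl fun m' => ?_
    rintro ⟨φ, ⟨l₁, l₂, new, hl, hQ, hr1, -, hr4, hr5, hmem, -⟩, hb⟩
    have : l₂ = [] := by
      rw [← List.length_eq_zero_iff]
      simp only [Test.Holds, hr4, hr5, hl, List.length_append] at hb
      omega
    subst this
    rw [List.append_nil] at hl
    exact ⟨new, hQ, hr1, fun w hw => hmem w (hl ▸ ((hadj v).2 w).2 hw)⟩
  · rintro φ m₀ ⟨l₁, l₂, new, hl, hQ, hr1, hr3, hr4, hr5, hmem, rfl⟩ hb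
    obtain ⟨w, l₂, rfl⟩ : ∃ w l, l₂ = w :: l := by
      cases l₂ with
      | nil => simp [Test.Holds, hr4, hr5, hl] at hb
      | cons w l => exact ⟨w, l, rfl⟩
    have hw : m₀.arr 1 (m₀.reg 4) = w := by
      rw [hr4, hQ.lists]
      exact inputMem_arr_one adj v (by simp [hl])
    have hvw : G.Adj v w := ((hadj v).2 w).1 (by simp [hl])
    refine ⟨1 + (1 + (((1 + (1 + (1 + 1))) + 1) + 1)), .seq (.load (.seq (.load (.seq (.cond
      (fun hlt => .seq (.store (.seq (.store (.seq (.store (.inc (.inc ?_))))))))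
      fun hlt => .mono (T₁ := 1) (.const (.inc ?_)) (by omega) fun _ => id)))))⟩
    · refine ⟨9 * l₂.length, by simp only [List.length_cons]; omega, l₁ ++ [w], l₂, new ++ [w],
        by simp [hl], ?_, ?_⟩
      · have hnot : w ∉ q ++ new := by
          intro hmem
          simp [Test.Holds, Mem.reg_setReg, hw, hQ.mark, hmem, hQ.one, Mem.arr_setReg] at hlt
        rw [← List.append_assoc]
        refine hQ.push (by simp [hv]) hnot hvw ?_ ?_ ?_
        · simp [Mem.reg_setReg, Mem.arr_setReg, Mem.setArr, hw, hQ.one, hr3, hQ.tail]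
        · simp [Mem.reg_setReg, Mem.reg_setArr, hQ.tail]
        · simp [Mem.reg_setReg, Mem.reg_setArr, hQ.one]
      · simp only [Mem.reg_setReg, Mem.reg_setArr]
        simp [hr1, hr3, hr4, hr5, Nat.add_assoc]
        rintro x (hx | rfl)
        · have := hmem x hx
          simp only [List.mem_append] at this
          tauto
        · simp
    · refine ⟨9 * l₂.length, by simp only [List.length_cons]; omega, l₁ ++ [w], l₂, new,
        by simp [hl], hQ.congr rfl (by simp [Mem.reg_setReg]) (by simp [Mem.reg_setReg]), ?_⟩
      have hwq : w ∈ q ++ new := by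
        by_contra hnot
        simp [Test.Holds, Mem.reg_setReg, hw, hQ.mark, hnot, hQ.one, Mem.arr_setReg] at hlt
      simp only [Mem.reg_setReg]
      simp [hr1, hr3, hr4, hr5, Nat.add_assoc]
      rintro x (hx | rfl)
      · simpa using hmem x hx
      · simpa using hwq
  · exact ⟨[], adj v, [], rfl, by simpa using hq, rfl, h3, by simpa using h4, h5, by simp, rfl⟩

/-- The program that reads the neighbours of the next vertex in the queue. -/
def searchStep : Prog :=
  .seq (.load 3 2 1) (.seq (.load 4 0 3) (.seq (.copy 5 3) (.seq (.inc 5) (.seq (.load 5 0 5)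
    (.seq (.loop (.lt 4 5) scanStep) (.inc 1))))))

theorem runs_search {n : ℕ} {G : SimpleGraph (Fin n)} {adj : Fin n → List (Fin n)}
    (hG : G.IsTree) (hadj : IsAdjList G adj) {m : Mem} {r : Fin n} (hq : Queue G adj m [r])
    (h1 : m.reg 1 = 0) :
    Runs (.loop (.lt 1 2) searchStep) m ((∑ v, (9 * (adj v).length + 8)) + 1) fun m' =>
      ∃ q, Queue G adj m' q ∧ ∀ v, v ∈ q := by
  -- Every vertex not yet processed pays for its scan, for the six other instructions and for the
  -- final test of the inner and the test of the outer loop.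
  set I : ℕ → Mem → Prop := fun φ m' => ∃ done pend, Queue G adj m' (done ++ pend) ∧
    m'.reg 1 = done.length ∧ (∀ x ∈ done, ∀ y, G.Adj x y → y ∈ done ++ pend) ∧
    φ = ∑ v ∈ done.toFinsetᶜ, (9 * (adj v).length + 8) with hI
  have hloop := Runs.loop (b := .lt 1 2) (p := searchStep) (I := I) (m := m)
    (φ := ∑ v, (9 * (adj v).length + 8)) ?_ ?_
  · refine hloop.mono le_rfl fun m' => ?_
    rintro ⟨φ, ⟨done, pend, hQ, hr1, hc, -⟩, hb⟩
    have : pend = [] := by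
      rw [← List.length_eq_zero_iff]
      simp only [Test.Holds, hr1, hQ.tail, List.length_append] at hb
      omega
    subst this
    rw [List.append_nil] at hQ hc
    exact ⟨done, hQ, hQ.order.eq_of_closed hG.connected hc⟩
  · rintro φ m₀ ⟨done, pend, hQ, hr1, hc, rfl⟩ hb
    obtain ⟨v, pend, rfl⟩ : ∃ v l, pend = v :: l := by
      cases pend with
      | nil => simp [Test.Holds, hr1, hQ.tail] at hb
      | cons w l => exact ⟨w, l, rfl⟩
    have hv : m₀.arr 2 (m₀.reg 1) = v := by
      rw [hr1]
      exact hQ.entry _ _ (by simp)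
    have hs : m₀.arr 0 v = listStart adj v := by
      rw [hQ.starts, inputMem_arr_zero adj v.2.le]
    have hs' : m₀.arr 0 (v + 1) = listStart adj v + (adj v).length := by
      rw [hQ.starts, inputMem_arr_zero adj v.2, listStart_succ]
    have hnd := hQ.order.nodup
    refine ⟨1 + (1 + (1 + (1 + (1 + ((9 * (adj v).length + 1) + 1))))),
      .seq (.load (.seq (.load (.seq (.copy (.seq (.inc (.seq (.load (.seq ?_)))))))))) ⟩
    refine Runs.mono (runs_scan hadj (v := v) (q := done ++ v :: pend) ?_ (by simp) ?_ ?_ ?_) le_rfl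
      fun m₁ => ?_
    · exact hQ.congr rfl (by simp [Mem.reg_setReg]) (by simp [Mem.reg_setReg])
    · simp [Mem.reg_setReg, hv]
    · simp [Mem.reg_setReg, Mem.arr_setReg, hv, hs]
    · simp [Mem.reg_setReg, Mem.arr_setReg, hv, hs']
    · rintro ⟨new, hQ', hr, hmem⟩
      have hassoc : done ++ v :: pend ++ new = (done ++ [v]) ++ (pend ++ new) := by simp
      refine .inc ⟨_, ?_, done ++ [v], pend ++ new, ?_, ?_, ?_, rfl⟩
      · have hins : done.toFinsetᶜ = insert v (done ++ [v]).toFinsetᶜ := by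
          have : v ∉ done := fun h => by
            rw [List.nodup_append] at hnd
            exact hnd.2.2 v h v (by simp) rfl
          ext x
          by_cases hx : x = v
          · simp [hx, this]
          · simp [hx]
        rw [hins, Finset.sum_insert (by simp)]
        omega
      · rw [← hassoc]
        exact hQ'.congr rfl (by simp [Mem.reg_setReg]) (by simp [Mem.reg_setReg])
      · simp [Mem.reg_setReg, hr, hr1]
      · intro x hx y hxy
        rw [← hassoc]
        rcases List.mem_append.1 hx with hx | hx
        · exact List.mem_append_left _ (hc x hx y hxy)
        · obtain rfl := List.mem_singleton.1 hx
          exact hmem y hxy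
  · exact ⟨[], [r], hq, h1, by simp, by simp⟩

/-! ### Evaluating the tree from the leaves upwards -/

/-- There are finitely many states. The code 0 is reserved for the fresh one, so that the initially
zero array `5` needs no initialisation. -/
theorem exists_code : ∃ (N : ℕ) (enc : PeelState → ℕ) (dec : ℕ → PeelState),
    dec 0 = PeelState.fresh ∧ ∀ s, enc s ≤ N ∧ dec (enc s) = s := by
  let e := Finite.equivFin PeelState
  refine ⟨Nat.card PeelState, fun s => (e s).val + 1, fun k => match k with
    | 0 => PeelState.fresh
    | k + 1 => if h : k < Nat.card PeelState then e.symm ⟨k, h⟩ else ∅, rfl, fun s =>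
    ⟨(e s).2, ?_⟩⟩
  exact (dif_pos (e s).2).trans (e.symm_apply_apply s)

/-- The program that removes the last vertex of the queue; `F` describes the effect on the codes of
the situations, which array `5` holds. -/
def peelStep (N : ℕ) (F : ℕ → ℕ → ℕ) : Prog :=
  .seq (.dec 2) (.seq (.load 3 2 2) (.seq (.load 6 3 3) (.seq (.load 4 5 6) (.seq (.load 5 5 3)
    (.seq (lookupProg F (pairsUpTo N)) (.store 5 6 8))))))

theorem runs_peel {n : ℕ} {G : SimpleGraph (Fin n)} {adj : Fin n → List (Fin n)}
    (hG : G.IsAcyclic) {N : ℕ} {enc : PeelState → ℕ} {dec : ℕ → PeelState}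
    (h0 : dec 0 = PeelState.fresh) (henc : ∀ s, enc s ≤ N ∧ dec (enc s) = s) {m : Mem}
    {q : List (Fin n)} (hq : Queue G adj m q) (hall : ∀ v, v ∈ q) :
    Runs (.loop (.lt 7 2) (peelStep N fun i j => enc ((dec i).merge (dec j)))) m
      ((4 * (pairsUpTo N).length + 8) * n + 1) fun m' => m'.arr 5 0 ≤ N ∧
        (RSColourable G 3 ↔ dec (m'.arr 5 0) ≠ ∅) := by
  set c := (pairsUpTo N).length
  -- Solvability on the remaining queue stays equivalent to colourability. A removal costs `4 * c +
  -- 8`: at most `4 * c + 1` for the look-up, six other instructions and the loop test.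
  set I : ℕ → Mem → Prop := fun φ m' => ∃ q : List (Fin n), m'.reg 2 = q.length ∧ m'.reg 7 = 1 ∧
    (∀ (i : ℕ) (w : Fin n), q[i]? = some w → m'.arr 2 i = w) ∧ SearchOrder G (m'.arr 3) q ∧
    (∀ w : ℕ, m'.arr 5 w ≤ N) ∧
    (RSColourable G 3 ↔ PeelSolvable G q.toFinset fun v => dec (m'.arr 5 v)) ∧
    φ = (4 * c + 8) * q.length with hI
  have hloop := Runs.loop (b := .lt 7 2)
    (p := peelStep N fun i j => enc ((dec i).merge (dec j))) (I := I) (m := m)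
    (φ := (4 * c + 8) * n) ?_ ?_
  · refine hloop.mono le_rfl fun m' => ?_
    rintro ⟨φ, ⟨q, h2, h7, -, hord, hN, hiff, -⟩, hb⟩
    simp only [Test.Holds, h2, h7] at hb
    cases hord with
    | single r hr =>
      rw [List.toFinset_cons, List.toFinset_nil, insert_empty_eq, peelSolvable_singleton,
        hr] at hiff
      exact ⟨hN 0, hiff⟩
    | snoc q u w _ hu =>
      have := List.length_pos_of_mem hu
      rw [List.length_append, List.length_singleton] at hb
      omega
  · rintro φ m₀ ⟨q, h2, h7, hent, hord, hN, hiff, rfl⟩ hb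
    simp only [Test.Holds, h2, h7] at hb
    generalize hpar : m₀.arr 3 = par at hord
    cases hord with
    | single r hr => simp at hb
    | snoc q u w hord hu hw huw huwpar =>
      have hlen : m₀.reg 2 - 1 = q.length := by simp [h2]
      have hw2 : m₀.arr 2 q.length = w := hent _ _ (by simp)
      have hu3 : m₀.arr 3 w = u := hpar ▸ huwpar
      refine ⟨1 + (1 + (1 + (1 + (1 + ((4 * c + 1) + 1))))),
        .seq (.dec (.seq (.load (.seq (.load (.seq (.load (.seq (.load (.seq ?_))))))))))⟩
      refine Runs.mono (runs_lookupProg _ (mem_pairsUpTo ?_ ?_)) le_rfl fun m₁ => ?_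
      · simpa [Mem.reg_setReg, Mem.arr_setReg] using hN _
      · simpa [Mem.reg_setReg, Mem.arr_setReg] using hN _
      · simp only [Mem.reg_setReg, Mem.arr_setReg]
        simp only [hlen, hw2, hu3, Nat.reduceEqDiff, if_true, if_false]
        rintro ⟨harr, hreg, h8⟩
        have h6 : m₁.reg 6 = u := by simp [hreg 6]
        refine .store ⟨(4 * c + 8) * q.length, ?_, q, ?_, ?_, ?_, ?_, ?_, ?_, rfl⟩
        · simp only [List.length_append, List.length_singleton, Nat.mul_add, Nat.mul_one]
          omega
        · simp [Mem.reg_setArr, hreg 2]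
        · simp [Mem.reg_setArr, hreg 7, h7]
        · intro i x hx
          have hi := (List.getElem?_eq_some_iff.1 hx).1
          simpa [Mem.arr_setArr, harr] using hent i x (by rw [List.getElem?_append_left hi, hx])
        · refine hord.congr fun x _ => ?_
          simp [Mem.arr_setArr, harr, hpar]
        · intro x
          rw [Mem.arr_setArr, harr]
          split_ifs
          · rw [h8]
            exact (henc _).1
          · exact hN x
        · have hfin : (q ++ [w]).toFinset = insert w q.toFinset := by
            ext x
            simp
          rw [hiff, hfin, peelSolvable_insert (List.mem_toFinset.2 hu)
            (fun h => hw (List.mem_toFinset.1 h))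
            fun x hx => hord.adj_iff hG hu hw huw (List.mem_toFinset.1 hx)]
          refine iff_of_eq (congrArg _ (funext fun x => ?_))
          rw [Function.update_apply, Mem.arr_setArr, harr, h6, h8]
          by_cases hx : x = u
          · simp [hx, (henc _).2]
          · simp [hx, Fin.val_inj]
  · refine ⟨q, hq.tail, hq.one, hq.entry, hq.order, fun w => by simp [hq.unused], ?_, ?_⟩
    · have : q.toFinset = Finset.univ := by
        ext x
        simp [hall x]
      simp only [hq.unused, h0, this]
      exact (peelSolvable_univ G).symm
    · have : q.length = n := by
        have := List.toFinset_card_of_nodup hq.order.nodup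
        rw [← this, show q.toFinset = Finset.univ by ext x; simp [hall x]]
        simp
      rw [this]

/-! ### The linear-time test -/

/-- The degrees of a tree sum to `2 * (n - 1)`, so the sum equals `18 * (n - 1) + 8 * n`. -/
theorem sum_length_adj {n : ℕ} {G : SimpleGraph (Fin n)} {adj : Fin n → List (Fin n)}
    (hG : G.IsTree) (hadj : IsAdjList G adj) : ∑ v, (9 * (adj v).length + 8) ≤ 26 * n := by
  classical
  have hdeg : ∀ v, (adj v).length = G.degree v := by
    intro v
    rw [← List.toFinset_card_of_nodup (hadj v).1, ← G.card_neighborFinset_eq_degree]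
    congr 1
    ext w
    simp [(hadj v).2]
  have h1 := G.sum_degrees_eq_twice_card_edges
  have h2 := hG.card_edgeFinset
  simp only [Fintype.card_fin] at h2
  simp only [hdeg, Finset.sum_add_distrib, ← Finset.mul_sum, h1]
  simp
  omega

theorem exists_linear_time_test : ∃ p : Prog, TestsTreesInLinearTime p := by
  classical
  obtain ⟨N, enc, dec, h0, henc⟩ := exists_code
  set F : ℕ → ℕ → ℕ := fun i j => enc ((dec i).merge (dec j)) with hF
  set F' : ℕ → ℕ → ℕ := fun i _ => if dec i = ∅ then 0 else 1 with hF'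
  set c := (pairsUpTo N).length with hc
  -- Vertex 0 is marked and the queue gets length 1; array `2` needs no write, as its entry 0 is
  -- already 0. The last look-up reuses `lookupProg` with a dummy second code 0 and tests whether
  -- the state left at vertex 0 is empty.
  refine ⟨.seq (.const 7 1) (.seq (.store 4 9 7) (.seq (.const 2 1) (.seq
    (.loop (.lt 1 2) searchStep) (.seq (.loop (.lt 7 2) (peelStep N F)) (.seq (.const 9 0)
    (.seq (.load 4 5 9) (.seq (.const 5 0) (.seq (lookupProg F' (pairsUpTo N)) (.copy 0 8))))))))),
    8 * c + 44, fun n G adj hG hadj => ?_⟩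
  obtain ⟨r, hr⟩ : ∃ r : Fin n, r.val = 0 := by
    obtain ⟨x⟩ := hG.connected.nonempty
    exact ⟨⟨0, x.pos⟩, rfl⟩
  have hn : 1 ≤ n := r.pos
  suffices h : Runs _ (inputMem adj) ((8 * c + 44) * n) fun m' =>
      (RSColourable G 3 → m'.reg 0 = 1) ∧ (¬ RSColourable G 3 → m'.reg 0 = 0) by
    obtain ⟨t, m', h1, h2, h3⟩ := h
    exact ⟨t, m', h1, h2, h3⟩
  have hsum := sum_length_adj hG hadj
  refine Runs.mono (T₁ := 1 + (1 + (1 + (((∑ v, (9 * (adj v).length + 8)) + 1) +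
    (((4 * c + 8) * n + 1) + (1 + (1 + (1 + ((4 * c + 1) + 1)))))))))
    (.seq (.const (.seq (.store (.seq (.const (.seq ?_))))))) ?_ fun _ => id
  · refine Runs.mono (runs_search hG hadj (r := r) ?_ ?_) le_rfl fun m₁ => ?_
    · refine ⟨?_, ?_, ?_, ?_, .single r hr, ?_, ?_, ?_⟩
      · simp [Mem.reg_setReg]
      · simp [Mem.reg_setReg, Mem.reg_setArr]
      · intro i w hi
        have hi' := (List.getElem?_eq_some_iff.1 hi).1
        simp only [List.length_singleton, Nat.lt_one_iff] at hi'
        subst hi'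
        obtain rfl : r = w := by simpa using hi
        simp [Mem.arr_setReg, Mem.arr_setArr, inputMem, hr]
      · intro w
        have hw : w.val = 0 ↔ w = r := by rw [← hr, Fin.val_inj]
        simp [Mem.arr_setReg, Mem.arr_setArr, Mem.reg_setReg, inputMem, hw]
      · funext i
        simp [Mem.arr_setReg, Mem.arr_setArr]
      · funext i
        simp [Mem.arr_setReg, Mem.arr_setArr]
      · intro w
        simp [Mem.arr_setReg, Mem.arr_setArr, inputMem]
    · simp [Mem.reg_setReg, Mem.reg_setArr, inputMem]
    · rintro ⟨q, hq, hall⟩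
      refine .seq (Runs.mono (runs_peel hG.isAcyclic h0 henc hq hall) le_rfl fun m₂ => ?_)
      rintro ⟨hle, hiff⟩
      refine .seq (.const (.seq (.load (.seq (.const (.seq ?_))))))
      refine Runs.mono (runs_lookupProg F' (mem_pairsUpTo ?_ ?_)) le_rfl fun m₃ => ?_
      · simpa [Mem.reg_setReg, Mem.arr_setReg] using hle
      · simp [Mem.reg_setReg]
      · rintro ⟨-, -, h8⟩
        refine .copy ?_
        have h4 : m₃.reg 8 = if dec (m₂.arr 5 0) = ∅ then 0 else 1 := by
          simpa [Mem.reg_setReg, Mem.arr_setReg, hF'] using h8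
        rw [hiff]
        simp only [Mem.reg_setReg, if_true, h4]
        exact ⟨fun h => if_neg h, fun h => if_pos (not_not.1 h)⟩
  -- The total is at most `(4 * c + 34) * n + 4 * c + 10`, and `1 ≤ n` absorbs the constants.
  · have h1 : c ≤ c * n := Nat.le_mul_of_pos_right c hn
    rw [Nat.add_mul, Nat.add_mul, Nat.mul_assoc, Nat.mul_assoc]
    omega

end RS

theorem mainTheorem4 :
    -- the two relations are equivalence relations
    Equivalence RS.BranchEquiv ∧
    Equivalence (fun R₁ R₂ : {R : RS.RTree // RS.IsRootedSubtree R} =>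
      RS.SubtreeEquiv R₁.1 R₂.1) ∧
    -- different representatives are inequivalent
    (∀ X Y : RS.BranchClass, RS.BranchEquiv X.rep Y.rep → X = Y) ∧
    (∀ X Y : RS.SubtreeClass, RS.SubtreeEquiv X.rep Y.rep → X = Y) ∧
    -- the classification of uncoloured branches and uncoloured rooted subtrees
    (∀ B : RS.Branch, B.toTree.Uncoloured → ∃! X : RS.BranchClass, RS.InBranchClass B X) ∧
    (∀ R : RS.RTree, RS.IsRootedSubtree R → R.Uncoloured →
      ∃! X : RS.SubtreeClass, RS.InSubtreeClass R X) ∧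
    -- the table for branches
    (∀ (R : RS.RTree) (d : ℕ) (X : RS.SubtreeClass), RS.IsRootedSubtree R → 1 ≤ d →
      RS.InSubtreeClass R X → RS.InBranchClass (RS.branchOver R d) (RS.branchTable d X)) ∧
    -- the table for rooted subtrees
    (∀ (R : RS.RTree) (L : List RS.BranchClass), RS.IsRootedSubtree R →
      (R.children = [] → R.colour = none) →
      List.Forall₂ (fun t X => RS.InBranchClass ⟨R.colour, t⟩ X) R.children L →
        RS.InSubtreeClass R (RS.subtreeTable L)) ∧
    -- the tables, applied from the bottom up, give the class and decide 3-rs colourability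
    (∀ R : RS.RTree, RS.IsRootedSubtree R → R.Uncoloured →
      RS.InSubtreeClass R (RS.tableClass R)) ∧
    (∀ T : RS.RTree, T.ThreePlusRoot → T.Uncoloured →
      (RS.RSColourable T.graph 3 ↔ RS.tableClass T ≠ RS.SubtreeClass.I)) ∧
    -- the linear-time algorithm
    (∃ p : RS.Prog, RS.TestsTreesInLinearTime p) := by
  refine ⟨RS.equivalence_branchEquiv, RS.equivalence_subtreeEquiv,
    fun _ _ => RS.BranchClass.eq_of_branchEquiv, fun _ _ => RS.SubtreeClass.eq_of_subtreeEquiv,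
    fun B _ => RS.existsUnique_inBranchClass B,
    fun R hR hu => ?_, fun R d X hR hd h => ?_, fun R L hR h0 h => ?_, fun R hR hu => ?_,
    fun T => RS.rsColourable_iff_tableClass, RS.exists_linear_time_test⟩
  · rw [RS.isRootedSubtree_iff] at hR
    have h := RS.inSubtreeClass_tableClass hR hu
    exact ⟨_, h, fun Y hY => RS.SubtreeClass.sig_injective
      (((RS.inSubtreeClass_iff_sig hR).1 hY).symm.trans ((RS.inSubtreeClass_iff_sig hR).1 h))⟩
  · exact RS.inBranchClass_iff.2
      (RS.branchSig_branchOver (h.pairSig_eq (RS.isRootedSubtree_iff.1 hR)) hd)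
  · refine RS.inSubtreeClass_subtreeTable (RS.isRootedSubtree_iff.1 hR) h0 (h.imp fun t X => ?_)
    exact RS.inBranchClass_iff.1
  · exact RS.inSubtreeClass_tableClass (RS.isRootedSubtree_iff.1 hR) hu
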